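/- A (nondeterministic) pushdown automaton $M=(Q,\Sigma,\Gamma,\delta,q_0,Z_0,F)$ has a one-way input, starts in state $q_0$ with pushdown $Z_0$, and accepts a word if some computation reads the whole word and ends in a final state; $L(M)\subseteq\Sigma^*$ is the set of accepted words and $\overline{L(M)}=\Sigma^*\setminus L(M)$. It is real-time if every transition reads an input letter, $2$-ambiguous if every word has at most two accepting computations, and $1$-reversal-bounded if on every input, in every computation, it changes at most once between non-decreasing and non-increasing the size of its pushdown. For a language $L$ over a finite alphabet let $f_L(n)$ be the number of words of length $n$ in $L$; $L$ is counting-regular if there is a regular language $L'$, over a possibly different finite alphabet, with $f_L(n)=f_{L'}(n)$ for all $n\ge 0$. Theorem. It is undecidable, given a real-time $2$-ambiguous $1$-reversal-bounded pushdown automaton $M$, whether $L(M)$ is counting-regular. It is also undecidable, given such an $M$, whether $\overline{L(M)}$ is counting-regular. That is, for neither of the two questions is there an algorithm that, on every (encoded) automaton $M$ with these three properties, halts with the correct answer (its behaviour on other inputs being arbitrary). -/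

import Mathlib

/-- The counting function of a language: the number of its words of length `n`.  (All alphabets
to which this is applied are finite, so the set of words below is finite.) -/
noncomputable def Language.count {α : Type} (L : Language α) (n : ℕ) : ℕ :=
  Set.ncard {w : List α | w ∈ L ∧ w.length = n}

/-- `L` is counting-regular: some regular language, over a finite alphabet of any size, has the
same counting function. -/
def Language.CountingRegular {α : Type} (L : Language α) : Prop :=
  ∃ (m : ℕ) (R : Language (Fin m)), R.IsRegular ∧ ∀ n, L.count n = R.count n

/-- A transition `(q, push) ∈ δ(p, a, Z)` of a pushdown automaton: in state `p = source`, with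
`Z = top` on top of the pushdown, read the letter `a` (`input = some a`), or nothing
(`input = none`), go to state `q = target` and replace `Z` by the word `push`, whose first symbol
becomes the new top of the pushdown. -/
structure PDATransition where
  source : ℕ
  input : Option ℕ
  top : ℕ
  target : ℕ
  push : List ℕ

/-- A nondeterministic pushdown automaton `(Q, Σ, Γ, δ, q₀, Z₀, F)` with acceptance by final state,
as a finite object.  The input alphabet is `Fin alphabetSize`.  States and pushdown symbols are
named by natural numbers, and `Q` and `Γ` consist of the finitely many names that occur.  The
finite set `δ` is given by a list, in which order and repetitions are irrelevant. A transition on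
a letter outside the input alphabet can never be applied. -/
structure PDA where
  alphabetSize : ℕ
  transitions : List PDATransition
  start : ℕ
  bottom : ℕ
  final : List ℕ

/-- A transition as a tuple of its components. -/
def PDATransition.equivProd : PDATransition ≃ ℕ × Option ℕ × ℕ × ℕ × List ℕ where
  toFun t := (t.source, t.input, t.top, t.target, t.push)
  invFun x := ⟨x.1, x.2.1, x.2.2.1, x.2.2.2.1, x.2.2.2.2⟩
  left_inv _ := rfl
  right_inv _ := rfl

instance : Primcodable PDATransition := Primcodable.ofEquiv _ PDATransition.equivProd

/-- A pushdown automaton as a tuple of its components. -/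
def PDA.equivProd : PDA ≃ ℕ × List PDATransition × ℕ × ℕ × List ℕ where
  toFun M := (M.alphabetSize, M.transitions, M.start, M.bottom, M.final)
  invFun x := ⟨x.1, x.2.1, x.2.2.1, x.2.2.2.1, x.2.2.2.2⟩
  left_inv _ := rfl
  right_inv _ := rfl

/-- The standard encoding of pushdown automata, under which they are inputs of algorithms. -/
instance : Primcodable PDA := Primcodable.ofEquiv _ PDA.equivProd

namespace PDA

/-- An instantaneous description: the state, the unread part of the input, and the contents of the
pushdown, top first. -/
structure Config (M : PDA) where
  state : ℕ
  unread : List (Fin M.alphabetSize)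
  stack : List ℕ

/-- `M.Step c t c'`: the transition `t` of `M` leads from `c` to `c'`. -/
inductive Step (M : PDA) : M.Config → PDATransition → M.Config → Prop
  | epsilon (p Z q : ℕ) (push γ : List ℕ) (w : List (Fin M.alphabetSize))
      (h : ⟨p, none, Z, q, push⟩ ∈ M.transitions) :
      Step M ⟨p, w, Z :: γ⟩ ⟨p, none, Z, q, push⟩ ⟨q, w, push ++ γ⟩
  | read (p Z q : ℕ) (push γ : List ℕ) (a : Fin M.alphabetSize) (w : List (Fin M.alphabetSize))
      (h : ⟨p, some (a : ℕ), Z, q, push⟩ ∈ M.transitions) :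
      Step M ⟨p, a :: w, Z :: γ⟩ ⟨p, some (a : ℕ), Z, q, push⟩ ⟨q, w, push ++ γ⟩

/-- `M.Run c r c'`: the finite sequence `r` of transitions is a computation of `M` from `c`
to `c'`. -/
inductive Run (M : PDA) : M.Config → List PDATransition → M.Config → Prop
  | nil (c : M.Config) : Run M c [] c
  | cons {c c' c'' : M.Config} {t : PDATransition} {r : List PDATransition}
      (h : M.Step c t c') (hr : Run M c' r c'') : Run M c (t :: r) c''

/-- The initial instantaneous description on input `w`. -/
def init (M : PDA) (w : List (Fin M.alphabetSize)) : M.Config := ⟨M.start, w, [M.bottom]⟩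

/-- `r` is an accepting computation of `M` on `w`: it starts in the initial instantaneous
description, reads the whole input and ends in a final state. -/
def AcceptingRun (M : PDA) (w : List (Fin M.alphabetSize)) (r : List PDATransition) : Prop :=
  ∃ q ∈ M.final, ∃ γ : List ℕ, M.Run (M.init w) r ⟨q, [], γ⟩

/-- The language accepted by `M`. -/
def language (M : PDA) : Language (Fin M.alphabetSize) := {w | ∃ r, M.AcceptingRun w r}

/-- `M` is real-time: it has no transitions that read no input letter. -/
def IsRealTime (M : PDA) : Prop := ∀ t ∈ M.transitions, t.input ≠ none

/-- `M` is `k`-ambiguous: every word has at most `k` accepting computations. -/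
def IsAmbiguous (M : PDA) (k : ℕ) : Prop :=
  ∀ w : List (Fin M.alphabetSize), {r | M.AcceptingRun w r}.encard ≤ k

/-- The sign of the change of the size of the pushdown that a transition makes: it replaces one
symbol by the word `push`. -/
def _root_.PDATransition.direction (t : PDATransition) : SignType :=
  match t.push with
  | [] => -1
  | [_] => 0
  | _ :: _ :: _ => 1

/-- The number of changes between increasing and decreasing in a sequence of directions, in which
`0` (size unchanged) is ignored; the first argument is the last nonzero direction so far, or `0`
if there has been none. -/
def reversals : SignType → List SignType → ℕ
  | _, [] => 0
  | s, d :: l =>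
    if d = 0 then reversals s l
    else if s = 0 ∨ s = d then reversals d l
    else reversals d l + 1

/-- `M` is `t`-reversal-bounded: in every computation (accepting or not, complete or not) on every
input, `M` changes at most `t` times between non-decreasing and non-increasing the size of its
pushdown. -/
def IsReversalBounded (M : PDA) (t : ℕ) : Prop :=
  ∀ (w : List (Fin M.alphabetSize)) (r : List PDATransition) (c : M.Config),
    M.Run (M.init w) r c → reversals 0 (r.map PDATransition.direction) ≤ t

end PDA

/-- The problem "given `a` with `promise a`, does `p a` hold?" is decidable: some algorithm halts
with the correct answer on every `a` that satisfies the promise.  Nothing is asked of it on other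
inputs; it need not even halt there. -/
def DecidableGiven {α : Type} [Primcodable α] (promise p : α → Prop) : Prop :=
  ∃ f : α →. Bool, Partrec f ∧ ∀ a, promise a → ∃ b ∈ f a, (b = true ↔ p a)

/-! The halting problem is reduced to both questions at once. A fixed one-dimensional cellular
automaton simulates a universal computation, and only its initial word `t` depends on the instance.
Let c₀ = t, c₁, c₂, … be the successive words of its evolution. With # for `sep` and $ for `mark`, a
halting history is the word # pᴿ $ c₀ᴿ $ p # x $, where p = c₁ # … # c₍ₘ₊₁₎, x = c₍ₘ₊₂₎ and x
contains a halting symbol. The automaton accepts exactly the words that are not halting histories.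

Two deterministic real-time tests recognise histories. One checks the shape # q $ c₀ᴿ $ qᴿ # x $ and
looks for a halting symbol in x. The other checks that the last part is, block by block, the image
of what the first two parts leave on the pushdown. Together they say that qᴿ # x is the image of c₀
# qᴿ; comparing first blocks repeatedly, this forces qᴿ to list the successors of c₀
(`append_eq_expected_iff`). Each test first stores and then only removes symbols, and it accepts
unless it succeeds exactly at the end of the input. The automaton chooses its test in the first step
and is deterministic afterwards. Hence it is 2-ambiguous and 1-reversal-bounded, and it rejects only
the words that pass both tests (`notMem_language_checkerPDA`).

If the evolution never halts, the language contains all words and its complement is empty, so both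
are counting-regular. If it halts, halting symbols persist, so from some m on there is one history
for each m. Its length is quadratic in m, so the lengths are unbounded with arbitrarily long gaps. A
counting function of a regular language satisfies a linear recurrence, hence cannot vanish on long
gaps without vanishing from there on. This excludes the complement, and after removing the term |Σ|ⁿ
it excludes the language too. -/

/-! ### Counting functions and linear recurrences -/

open Polynomial in
/-- If a sequence `l (T ^ n v)`, with `T` an endomorphism of a finite-dimensional space, has
`finrank` consecutive zeros, then it vanishes from there on. -/
theorem LinearMap.iterate_eq_zero_of_consecutive {K V : Type*} [Field K] [AddCommGroup V]
    [Module K V] [FiniteDimensional K V] (T : V →ₗ[K] V) (l : V →ₗ[K] K) (v : V) (N : ℕ)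
    (h : ∀ i < Module.finrank K V, l ((T ^ (N + i)) v) = 0) (n : ℕ) : l ((T ^ (N + n)) v) = 0 := by
  induction n using Nat.strong_induction_on with
  | _ n ih =>
    rcases lt_or_ge n (Module.finrank K V) with hn | hn
    · exact h n hn
    · obtain ⟨k, rfl⟩ := Nat.exists_eq_add_of_le hn
      -- By Cayley–Hamilton, the power of `T` with exponent `finrank` is a combination of lower
      -- powers. Applied to an iterate of `v`, these give only values of smaller index, which vanish
      -- by induction.
      have h0 := LinearMap.aeval_self_charpoly T
      have hm := LinearMap.charpoly_monic T
      have hd := LinearMap.charpoly_natDegree T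
      rw [aeval_eq_sum_range, hd, Finset.sum_range_succ] at h0
      have hc : T.charpoly.coeff (Module.finrank K V) = 1 := by rw [← hd]; exact hm
      rw [hc, one_smul] at h0
      have h1 := congrArg (fun S : V →ₗ[K] V => l (S ((T ^ (N + k)) v))) h0
      simp only [LinearMap.add_apply, LinearMap.sum_apply, LinearMap.smul_apply, map_add, map_sum,
        map_smul, LinearMap.zero_apply, map_zero, smul_eq_mul, ← Module.End.mul_apply,
        ← pow_add] at h1
      rw [Finset.sum_eq_zero, zero_add] at h1
      · rw [← h1]; congr 3; omega
      · intro i hi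
        have := ih (i + k) (by have := Finset.mem_range.1 hi; omega)
        rw [show i + (N + k) = N + (i + k) by omega, this, mul_zero]

/-- The number of words of length `n` accepted by a DFA from a state `s`, as a vector indexed by
the states. -/
noncomputable def DFA.countFrom {α σ : Type} (M : DFA α σ) (n : ℕ) (s : σ) : ℕ :=
  Set.ncard {w : List α | M.evalFrom s w ∈ M.accept ∧ w.length = n}

/-- Sorting words by their first letter makes the vector of counts evolve under a linear map. -/
theorem DFA.countFrom_succ {α σ : Type} [Fintype α] (M : DFA α σ) (n : ℕ) (s : σ) :
    M.countFrom (n + 1) s = ∑ a, M.countFrom n (M.step s a) := by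
  classical
  have hfin : ∀ s : σ, {w : List α | M.evalFrom s w ∈ M.accept ∧ w.length = n}.Finite := fun s =>
    (List.finite_length_eq α n).subset fun w hw => hw.2
  have : {w : List α | M.evalFrom s w ∈ M.accept ∧ w.length = n + 1} =
      ((Finset.univ : Finset α).biUnion fun a =>
        (hfin (M.step s a)).toFinset.image (List.cons a) : Finset (List α)) := by
    ext w
    cases w with
    | nil => simp
    | cons a w => simp
  unfold DFA.countFrom
  rw [this, Set.ncard_coe_finset, Finset.card_biUnion]
  · refine Finset.sum_congr rfl fun a _ => ?_
    rw [Finset.card_image_of_injective _ List.cons_injective, ← Set.ncard_eq_toFinset_card _ (hfin _)]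
  · intro a _ b _ hab
    simp only [Function.onFun, Finset.disjoint_left, Finset.mem_image, not_exists, not_and]
    rintro _ ⟨w, _, rfl⟩ w' _ h
    exact hab (List.cons.inj h).1.symm

/-- The counting function of a counting-regular language has a finite-dimensional linear
representation. -/
theorem Language.CountingRegular.exists_linear {α : Type} {L : Language α}
    (h : L.CountingRegular) :
    ∃ (d : ℕ) (T : (Fin d → ℚ) →ₗ[ℚ] (Fin d → ℚ)) (l : (Fin d → ℚ) →ₗ[ℚ] ℚ) (v : Fin d → ℚ),
      ∀ n, (L.count n : ℚ) = l ((T ^ n) v) := by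
  obtain ⟨m, R, ⟨σ, _, M, rfl⟩, hc⟩ := h
  let e := Fintype.equivFin σ
  -- `T` is the transfer operator, the sum over all letters of the pullback along a step. The vector
  -- is the indicator of the accepting states, and `l` reads the coordinate of the start state.
  refine ⟨Fintype.card σ,
    ∑ a : Fin m, LinearMap.funLeft ℚ ℚ fun i => e (M.step (e.symm i) a),
    LinearMap.proj (e M.start), fun i => M.countFrom 0 (e.symm i), fun n => ?_⟩
  have key : ∀ n, ((∑ a : Fin m, LinearMap.funLeft ℚ ℚ fun i => e (M.step (e.symm i) a)) ^ n)
      (fun i => (M.countFrom 0 (e.symm i) : ℚ)) = fun i => (M.countFrom n (e.symm i) : ℚ) := by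
    intro n
    induction n with
    | zero => rfl
    | succ n ih =>
      rw [pow_succ', Module.End.mul_apply, ih]
      ext i
      simp [LinearMap.funLeft_apply, DFA.countFrom_succ]
  rw [key, hc]
  simp only [LinearMap.proj_apply, Equiv.symm_apply_apply]
  rfl

theorem Language.count_eq_zero_iff {α : Type} [Finite α] (L : Language α) (n : ℕ) :
    L.count n = 0 ↔ ∀ w ∈ L, w.length ≠ n := by
  unfold Language.count
  rw [Set.ncard_eq_zero ((List.finite_length_eq α n).subset fun w hw => hw.2)]
  simp [Set.eq_empty_iff_forall_notMem]

theorem Language.count_add_count_compl {α : Type} [Fintype α] (L : Language α) (n : ℕ) :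
    L.count n + (Lᶜ).count n = Fintype.card α ^ n := by
  have hf := List.finite_length_eq α n
  have h1 : {w : List α | w.length = n} =
      {w | w ∈ L ∧ w.length = n} ∪ {w | w ∈ Lᶜ ∧ w.length = n} := by
    ext w
    exact ⟨fun h => (em (w ∈ L)).imp (⟨·, h⟩) (⟨·, h⟩), fun h => h.elim (·.2) (·.2)⟩
  have hd : Disjoint {w | w ∈ L ∧ w.length = n} {w | w ∈ Lᶜ ∧ w.length = n} :=
    Set.disjoint_left.2 fun w hw hw' => hw'.1 hw.1
  unfold Language.count
  rw [← Set.ncard_union_eq hd (hf.subset fun w hw => hw.2) (hf.subset fun w hw => hw.2), ← h1]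
  have : {w : List α | w.length = n} = Set.range (Subtype.val : List.Vector α n → List α) := by
    ext w; simp
  rw [this, ← Set.image_univ, Set.ncard_image_of_injective _ Subtype.val_injective, Set.ncard_univ]
  exact (Nat.card_eq_fintype_card (α := List.Vector α n)).trans (card_vector n)

/-- The lengths of the words of `L` are unbounded, but leave arbitrarily long gaps. -/
def Language.HasLengthGaps {α : Type} (L : Language α) : Prop :=
  ∀ d : ℕ, ∃ N, (∀ w ∈ L, w.length < N ∨ N + d ≤ w.length) ∧ ∃ w ∈ L, N ≤ w.length

/-- A gap as long as the dimension of the linear representation gives enough consecutive zeros to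
make the count vanish ever after, against the existence of a word beyond the gap. -/
theorem Language.HasLengthGaps.not_countingRegular {α : Type} [Finite α] {L : Language α}
    (h : L.HasLengthGaps) : ¬ L.CountingRegular := by
  intro hL
  obtain ⟨d, T, l, v, hT⟩ := hL.exists_linear
  obtain ⟨N, hN, w, hw, hwN⟩ := h d
  obtain ⟨k, hk⟩ := Nat.exists_eq_add_of_le hwN
  have := LinearMap.iterate_eq_zero_of_consecutive T l v N (fun i hi => by
    rw [Module.finrank_fin_fun] at hi
    rw [← hT, Nat.cast_eq_zero, L.count_eq_zero_iff]
    intro w hw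
    have := hN w hw
    omega) k
  rw [← hT, Nat.cast_eq_zero, L.count_eq_zero_iff] at this
  exact this w hw hk

/-- With c letters and g the count of the complement, the count of `L` is cⁿ − g(n). Replacing `v`
by `T v - c • v` removes cⁿ and leaves c·g(n) − g(n+1). Once this vanishes from the gap on, g is
geometric there with initial value 0, hence zero. -/
theorem Language.HasLengthGaps.not_countingRegular_of_compl {α : Type} [Finite α]
    {L : Language α} (h : (Lᶜ).HasLengthGaps) : ¬ L.CountingRegular := by
  intro hL
  have := Fintype.ofFinite α
  obtain ⟨d, T, l, v, hT⟩ := hL.exists_linear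
  -- Each value of c·g(n) − g(n+1) involves two consecutive values of g, so `d` zeros of it need a
  -- gap of length `d + 1`.
  obtain ⟨N, hN, w, hw, hwN⟩ := h (d + 1)
  have hsum := fun n => congrArg (Nat.cast (R := ℚ)) (L.count_add_count_compl n)
  push_cast at hsum
  set c : ℚ := (Fintype.card α : ℚ)
  have hg : ∀ n, l ((T ^ n) (T v - c • v)) =
      -(((Lᶜ).count (n + 1) : ℚ) - c * (Lᶜ).count n) := by
    intro n
    have e : (T ^ n) (T v) = (T ^ (n + 1)) v := by rw [pow_succ, Module.End.mul_apply]
    rw [map_sub, map_smul, map_sub, map_smul, smul_eq_mul, e, ← hT, ← hT]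
    have h1 := hsum n
    have h2 := hsum (n + 1)
    rw [pow_succ] at h2
    linear_combination h2 - c * h1
  have hz : ∀ i < d + 1, (Lᶜ).count (N + i) = 0 := by
    intro i hi
    rw [Language.count_eq_zero_iff]
    intro w hw
    have := hN w hw
    omega
  have hstep := LinearMap.iterate_eq_zero_of_consecutive T l (T v - c • v) N (fun i hi => by
    rw [Module.finrank_fin_fun] at hi
    rw [hg, hz i (by omega), show N + i + 1 = N + (i + 1) by omega, hz (i + 1) (by omega)]
    simp)
  have hall : ∀ k, ((Lᶜ).count (N + k) : ℚ) = 0 := by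
    intro k
    induction k with
    | zero => exact_mod_cast hz 0 (by omega)
    | succ k ih =>
      have := hstep k
      rw [hg, ih, mul_zero, sub_zero, neg_eq_zero] at this
      exact this
  obtain ⟨k, hk⟩ := Nat.exists_eq_add_of_le hwN
  have := hall k
  rw [Nat.cast_eq_zero, Language.count_eq_zero_iff] at this
  exact this w hw hk

theorem Language.countingRegular_of_forall_mem {k : ℕ} {L : Language (Fin k)}
    (h : ∀ w, w ∈ L) : L.CountingRegular :=
  ⟨k, _, ⟨Unit, inferInstance, ⟨fun _ _ => (), (), Set.univ⟩, rfl⟩, fun n => by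
    congr 1; ext w; exact iff_of_true (h w) trivial⟩

theorem Language.countingRegular_of_forall_notMem {k : ℕ} {L : Language (Fin k)}
    (h : ∀ w, w ∉ L) : L.CountingRegular :=
  ⟨k, _, ⟨Unit, inferInstance, ⟨fun _ _ => (), (), ∅⟩, rfl⟩, fun n => by
    congr 1; ext w; exact iff_of_false (h w) id⟩

/-! ### Cellular automata on finite words -/

/-- A one-dimensional cellular automaton: an alphabet with a blank symbol, a local rule whose
arguments are the right neighbour, the cell itself and the left neighbour, and a set of halting
symbols. -/
structure CellAutomaton (A : Type) where
  blank : A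
  rule : A → A → A → A
  halting : A → Prop
  halting_rule : ∀ x u v, halting u → halting (rule x u v)

namespace CellAutomaton

variable {A : Type} (C : CellAutomaton A)

/-- The images of the cells of `t`, where `v`, `u` precede `t` and blanks follow it. -/
def scan : A → A → List A → List A
  | u, v, [] => [C.rule C.blank u v, C.rule C.blank C.blank u]
  | u, v, x :: t => C.rule x u v :: scan x u t

/-- One step of the automaton on a finite word surrounded by blanks, which makes the word longer
by a letter at each end. -/
def next (t : List A) : List A := C.scan C.blank C.blank t

/-- A halting symbol occurs sooner or later in the evolution of `t`. -/
def Halts (t : List A) : Prop := ∃ m, ∃ a ∈ C.next^[m] t, C.halting a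

@[simp]
theorem length_scan (u v : A) (t : List A) : (C.scan u v t).length = t.length + 2 := by
  induction t generalizing u v with
  | nil => rfl
  | cons x t ih => simp [scan, ih]

@[simp]
theorem length_next (t : List A) : (C.next t).length = t.length + 2 := C.length_scan _ _ t

theorem length_iterate_next (m : ℕ) (t : List A) :
    (C.next^[m] t).length = t.length + 2 * m := by
  induction m generalizing t with
  | zero => rfl
  | succ m ih => rw [Function.iterate_succ_apply, ih, length_next]; omega

/-- The bi-infinite word consisting of `t`, at the positions from `0` on, and blanks. -/
def extend (t : List A) (i : ℤ) : A := if 0 ≤ i then t.getD i.toNat C.blank else C.blank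

theorem extend_of_neg (t : List A) {i : ℤ} (h : i < 0) : C.extend t i = C.blank := by
  simp [extend, not_le.2 h]

theorem extend_natCast (t : List A) (i : ℕ) : C.extend t i = t.getD i C.blank := by
  simp [extend]

theorem getD_scan (hb : C.rule C.blank C.blank C.blank = C.blank) (u v : A) (t : List A) (i : ℕ) :
    (C.scan u v t).getD i C.blank =
      C.rule ((v :: u :: t).getD (i + 2) C.blank) ((v :: u :: t).getD (i + 1) C.blank)
        ((v :: u :: t).getD i C.blank) := by
  induction t generalizing u v i with
  | nil => rcases i with _ | _ | _ <;> simp [scan, hb]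
  | cons x t ih =>
    cases i with
    | zero => simp [scan]
    | succ i => simpa [scan] using ih x u i

/-- The new word starts one cell further to the left, so its position `i` lies over position `i - 1`
of the old one. The blank rule covers everything outside the word. -/
theorem extend_next (hb : C.rule C.blank C.blank C.blank = C.blank) (t : List A) (i : ℤ) :
    C.extend (C.next t) i = C.rule (C.extend t i) (C.extend t (i - 1)) (C.extend t (i - 2)) := by
  rcases lt_or_ge i 0 with h | h
  · rw [extend_of_neg _ _ h, extend_of_neg _ _ h, extend_of_neg _ _ (by omega),
      extend_of_neg _ _ (by omega), hb]
  · lift i to ℕ using h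
    rw [extend_natCast, next, getD_scan _ hb]
    rcases i with _ | _ | i
    · rw [extend_natCast, C.extend_of_neg t (i := ((0 : ℕ) : ℤ) - 1) (by norm_num),
        C.extend_of_neg t (i := ((0 : ℕ) : ℤ) - 2) (by norm_num)]
      simp
    · rw [extend_natCast, C.extend_of_neg t (i := ((0 + 1 : ℕ) : ℤ) - 2) (by norm_num),
        show (((0 + 1 : ℕ) : ℤ) - 1) = (0 : ℕ) by norm_num, extend_natCast]
      simp
    · rw [extend_natCast, show (((i + 1 + 1 : ℕ) : ℤ) - 1) = (i + 1 : ℕ) by push_cast; ring,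
        show (((i + 1 + 1 : ℕ) : ℤ) - 2) = (i : ℕ) by push_cast; ring, extend_natCast,
        extend_natCast]
      simp

theorem exists_extend_eq_of_mem {t : List A} {a : A} (h : a ∈ t) : ∃ i, C.extend t i = a := by
  obtain ⟨i, hi, rfl⟩ := List.getElem_of_mem h
  exact ⟨i, by rw [extend_natCast, List.getD_eq_getElem _ _ hi]⟩

theorem extend_mem_or (t : List A) (i : ℤ) : C.extend t i ∈ t ∨ C.extend t i = C.blank := by
  rcases lt_or_ge i 0 with h | h
  · exact .inr (C.extend_of_neg t h)
  · lift i to ℕ using h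
    rw [extend_natCast]
    rcases lt_or_ge i t.length with h | h
    · rw [List.getD_eq_getElem _ _ h]; exact .inl (List.getElem_mem h)
    · exact .inr (List.getD_eq_default _ _ h)

/-- The image under a bijection of alphabets. -/
def congr {B : Type} (e : A ≃ B) : CellAutomaton B where
  blank := e C.blank
  rule x u v := e (C.rule (e.symm x) (e.symm u) (e.symm v))
  halting b := C.halting (e.symm b)
  halting_rule x u v h := by simpa using C.halting_rule _ _ _ h

theorem congr_next {B : Type} (e : A ≃ B) (t : List A) :
    (C.congr e).next (t.map e) = (C.next t).map e := by
  have : ∀ u v, (C.congr e).scan (e u) (e v) (t.map e) = (C.scan u v t).map e := by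
    induction t with
    | nil => intro u v; simp [scan, congr]
    | cons x t ih => intro u v; simp [scan, ih]; simp [congr]
  exact this _ _

theorem congr_halts_iff {B : Type} (e : A ≃ B) (t : List A) :
    (C.congr e).Halts (t.map e) ↔ C.Halts t := by
  have : ∀ m, (C.congr e).next^[m] (t.map e) = (C.next^[m] t).map e := by
    intro m
    induction m generalizing t with
    | zero => rfl
    | succ m ih => rw [Function.iterate_succ_apply, congr_next, ih, Function.iterate_succ_apply]
  unfold Halts
  simp [this]
  simp [congr]

/-- A cell with a halting symbol keeps one. Since blank is not halting, that cell never falls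
outside the word. This provides halting histories of all large lengths of computation. -/
theorem Halts.exists_forall_ge {C : CellAutomaton A}
    (hb : C.rule C.blank C.blank C.blank = C.blank) (hh : ¬ C.halting C.blank) {t : List A}
    (h : C.Halts t) : ∃ m, ∀ k ≥ m, ∃ a ∈ C.next^[k] t, C.halting a := by
  obtain ⟨m, hm⟩ := h
  refine ⟨m, fun k hk => ?_⟩
  induction k, hk using Nat.le_induction with
  | base => exact hm
  | succ k _ ih =>
    obtain ⟨a, ha, hah⟩ := ih
    obtain ⟨i, rfl⟩ := C.exists_extend_eq_of_mem ha
    rw [Function.iterate_succ_apply']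
    have hi := C.halting_rule (C.extend (C.next^[k] t) (i + 1)) (C.extend (C.next^[k] t) i)
      (C.extend (C.next^[k] t) (i - 1)) hah
    have he := C.extend_next hb (C.next^[k] t) (i + 1)
    rw [add_sub_cancel_right, show i + 1 - 2 = i - 1 by ring] at he
    rw [← he] at hi
    refine ⟨_, (C.extend_mem_or _ _).resolve_right fun h => hh (h ▸ hi), hi⟩

end CellAutomaton

/-! ### Simulation of Turing machines by cellular automata -/

namespace Turing.TM0

variable {Γ Λ : Type} [Inhabited Γ] [Inhabited Λ] (M : Machine Γ Λ) (S : Set Λ)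

/-- The state of the machine in the next cell in direction `d`, if the head moves there from a
cell with content `c`. -/
def outgoing (d : Dir) (c : Γ × Option S) : Option Λ :=
  match c.2 with
  | none => none
  | some q =>
    match M q c.1 with
    | some (q', .move d') => if d' = d then some q' else none
    | _ => none

open scoped Classical in
/-- The part in `S` of an optional state. -/
noncomputable def restrict (q : Option Λ) : Option S :=
  q.bind fun q => if h : q ∈ S then some ⟨q, h⟩ else none

omit [Inhabited Λ] in
theorem restrict_some {q : Λ} (h : q ∈ S) : restrict S (some q) = some ⟨q, h⟩ := by
  simp [restrict, h]

/-- The new content of the cell `u` between the cells `v` and `x`. -/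
noncomputable def cellRule (x u v : Γ × Option S) : Γ × Option S :=
  match u.2 with
  | none => (u.1, restrict S (outgoing M S .right v <|> outgoing M S .left x))
  | some q =>
    match M q u.1 with
    | none => u
    | some (q', .write a) => (a, restrict S (some q'))
    | some (_, .move _) => (u.1, none)

/-- The cellular automaton that simulates a Turing machine with states in `S`: a cell contains a
tape symbol, and the state if the head is there. -/
noncomputable def toCellAutomaton : CellAutomaton (Γ × Option S) where
  blank := (default, none)
  rule := cellRule M S
  halting c := ∃ q ∈ c.2, M q c.1 = none
  halting_rule := by
    rintro x ⟨a, _ | q⟩ v ⟨q', hq, h⟩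
    · simp at hq
    · cases Option.mem_some_iff.1 hq
      exact ⟨q, by simp [cellRule, h], by simp [cellRule, h]⟩

/-- The word `t` represents the configuration `c`. -/
def Represents (t : List (Γ × Option S)) (c : Cfg Γ Λ) : Prop :=
  ∃ (k : ℤ) (h : c.q ∈ S), ∀ i, (toCellAutomaton M S).extend t i =
    (c.Tape.nth (i - k), if i = k then some ⟨c.q, h⟩ else none)

theorem toCellAutomaton_blank :
    (toCellAutomaton M S).rule (toCellAutomaton M S).blank (toCellAutomaton M S).blank
      (toCellAutomaton M S).blank = (toCellAutomaton M S).blank := by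
  simp [toCellAutomaton, cellRule, outgoing, restrict]

theorem not_halting_blank : ¬ (toCellAutomaton M S).halting (toCellAutomaton M S).blank := by
  simp [toCellAutomaton]

variable {M S}

/-- Only the head cell and its two neighbours can change. `Supports` keeps the new state in `S`, so
`restrict` does not lose it. -/
theorem Represents.next (hS : Supports M S) {t : List (Γ × Option S)} {c c' : Cfg Γ Λ}
    (h : Represents M S t c) (hc : step M c = some c') :
    Represents M S ((toCellAutomaton M S).next t) c' := by
  have hq' := step_supports M hS hc
  obtain ⟨k, hq, hk⟩ := h
  replace hq' := hq' hq
  obtain ⟨q, T⟩ := c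
  obtain ⟨⟨q', s⟩, hM, rfl⟩ := Option.map_eq_some_iff.1 hc
  simp only at hq hq' hk hM
  have hh : T.nth 0 = T.head := T.nth_zero
  -- Here `j` is the position relative to the old head, and the index `j + 1 + k` includes the shift
  -- of the origin.
  have hext : ∀ j, (toCellAutomaton M S).extend ((toCellAutomaton M S).next t) (j + 1 + k) =
      cellRule M S (T.nth (j + 1), if j = -1 then some ⟨q, hq⟩ else none)
        (T.nth j, if j = 0 then some ⟨q, hq⟩ else none)
        (T.nth (j - 1), if j = 1 then some ⟨q, hq⟩ else none) := by
    intro j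
    rw [CellAutomaton.extend_next _ (toCellAutomaton_blank M S), hk, hk, hk]
    change cellRule M S _ _ _ = _
    have e1 : j + 1 + k = k ↔ j = -1 := by omega
    have e2 : j + 1 + k - 1 = k ↔ j = 0 := by omega
    have e3 : j + 1 + k - 2 = k ↔ j = 1 := by omega
    rw [if_congr e1 rfl rfl, if_congr e2 rfl rfl, if_congr e3 rfl rfl,
      show j + 1 + k - k = j + 1 by ring, show j + 1 + k - 1 - k = j by ring,
      show j + 1 + k - 2 - k = j - 1 by ring]
  have hj : ∀ i, ∃ j, i = j + 1 + k := fun i => ⟨i - 1 - k, by ring⟩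
  cases s with
  | write a =>
    -- The shift of the origin adds 1 to the index of the head. This gives `k + 1` for a write, and
    -- `k` and `k + 2` for moves to the left and to the right.
    refine ⟨k + 1, hq', fun i => ?_⟩
    obtain ⟨j, rfl⟩ := hj i
    rw [hext, show j + 1 + k - (k + 1) = j by ring]
    by_cases h0 : j = 0
    · subst h0
      have hw : (T.write a).head = a := rfl
      simp [cellRule, hh, hM, restrict_some S hq', add_comm, hw]
    · have h0' : j + 1 + k ≠ k + 1 := by omega
      by_cases h1 : j = -1
      · subst h1; simp [cellRule, outgoing, hh, hM, restrict, Tape.write_nth]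
      · by_cases h2 : j = 1
        · subst h2; simp [cellRule, outgoing, hh, hM, restrict, Tape.write_nth]; omega
        · simp [cellRule, outgoing, h0, h0', h1, h2, restrict, Tape.write_nth]
  | move d =>
    cases d with
    | left =>
      refine ⟨k, hq', fun i => ?_⟩
      obtain ⟨j, rfl⟩ := hj i
      rw [hext, show j + 1 + k - k = j + 1 by ring]
      by_cases h1 : j = -1
      · have hw : (T.move .left).head = T.nth (-1) := by
          rw [← Tape.nth_zero, Tape.move_left_nth]; rfl
        subst h1
        simp [cellRule, outgoing, hh, hM, restrict_some S hq', hw]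
      · have h1' : j + 1 + k ≠ k := by omega
        by_cases h0 : j = 0
        · subst h0; simp [cellRule, hh, hM, Tape.move_left_nth]
        · by_cases h2 : j = 1
          · subst h2; simp [cellRule, outgoing, hh, hM, restrict, Tape.move_left_nth]
          · simp [cellRule, outgoing, h0, h1', h1, h2, restrict, Tape.move_left_nth]
    | right =>
      refine ⟨k + 2, hq', fun i => ?_⟩
      obtain ⟨j, rfl⟩ := hj i
      rw [hext, show j + 1 + k - (k + 2) = j - 1 by ring]
      by_cases h2 : j = 1
      · subst h2
        have hw : (T.move .right).head = T.nth 1 := by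
          rw [← Tape.nth_zero, Tape.move_right_nth]; rfl
        simp [cellRule, outgoing, hh, hM, restrict_some S hq', hw, add_comm k 2]
      · have h2' : j + 1 + k ≠ k + 2 := by omega
        by_cases h0 : j = 0
        · subst h0; simp [cellRule, hh, hM, Tape.move_right_nth]; omega
        · by_cases h1 : j = -1
          · subst h1; simp [cellRule, outgoing, hh, hM, restrict, Tape.move_right_nth]
          · simp [cellRule, outgoing, h0, h2', h1, h2, restrict, Tape.move_right_nth]

theorem Represents.halting_of_step_eq_none {t : List (Γ × Option S)} {c : Cfg Γ Λ}
    (h : Represents M S t c) (hc : step M c = none) :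
    ∃ a ∈ t, (toCellAutomaton M S).halting a := by
  obtain ⟨k, hq, hk⟩ := h
  have hM : M c.q c.Tape.head = none := Option.map_eq_none_iff.1 hc
  have hka := hk k
  rw [sub_self, if_pos rfl, Tape.nth_zero] at hka
  have hh : (toCellAutomaton M S).halting ((toCellAutomaton M S).extend t k) := by
    rw [hka]; exact ⟨_, rfl, hM⟩
  exact ⟨_, (CellAutomaton.extend_mem_or _ _ _).resolve_right fun h =>
    not_halting_blank M S (h ▸ hh), hh⟩

theorem Represents.step_eq_none_of_halting {t : List (Γ × Option S)} {c : Cfg Γ Λ}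
    (h : Represents M S t c) {a : Γ × Option S} (ha : a ∈ t)
    (hh : (toCellAutomaton M S).halting a) : step M c = none := by
  obtain ⟨k, hq, hk⟩ := h
  obtain ⟨i, rfl⟩ := (toCellAutomaton M S).exists_extend_eq_of_mem ha
  rw [hk] at hh
  obtain ⟨q, hqi, hM⟩ := hh
  by_cases hi : i = k
  · subst hi
    simp only [if_true, Option.mem_some_iff] at hqi
    subst hqi
    rw [sub_self, Tape.nth_zero] at hM
    exact Option.map_eq_none_iff.2 hM
  · simp [hi] at hqi

theorem Represents.halts_iff (hS : Supports M S) {t : List (Γ × Option S)} {c : Cfg Γ Λ}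
    (h : Represents M S t c) :
    (toCellAutomaton M S).Halts t ↔ (StateTransition.eval (step M) c).Dom := by
  constructor
  · rintro ⟨m, a, ha, hh⟩
    induction m generalizing t c with
    | zero =>
      exact Part.dom_iff_mem.2 ⟨c, StateTransition.mem_eval.2
        ⟨.refl, h.step_eq_none_of_halting ha hh⟩⟩
    | succ m ih =>
      cases hc : step M c with
      -- The halting symbol may be observed after the machine has already stopped.
      | none => exact Part.dom_iff_mem.2 ⟨c, StateTransition.mem_eval.2 ⟨.refl, hc⟩⟩
      | some c' =>
        rw [StateTransition.reaches_eval (.single hc)]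
        exact ih (h.next hS hc) ha
  · intro hd
    obtain ⟨b, hb⟩ := Part.dom_iff_mem.1 hd
    obtain ⟨hr, hb'⟩ := StateTransition.mem_eval.1 hb
    clear hd hb
    induction hr using Relation.ReflTransGen.head_induction_on generalizing t with
    | refl => exact ⟨0, h.halting_of_step_eq_none hb'⟩
    | head hc _ ih =>
      obtain ⟨m, a, ha, hh⟩ := ih (h.next hS hc)
      exact ⟨m + 1, a, ha, hh⟩

/-- The word that represents the initial configuration with input `l`. -/
def initWord (h : default ∈ S) (l : List Γ) : List (Γ × Option S) :=
  (l.headI, some ⟨default, h⟩) :: l.tail.map fun a => (a, none)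

theorem represents_initWord (h : default ∈ S) (l : List Γ) :
    Represents M S (initWord h l) (init l) := by
  refine ⟨0, h, fun i => ?_⟩
  have hR : ∀ n : ℕ, (ListBlank.mk l).nth n = l.getD n default := fun n => by
    rw [ListBlank.nth_mk, List.getI_eq_getElem?_getD, List.getD_eq_getElem?_getD]
  rw [sub_zero]
  rcases lt_or_ge i 0 with hi | hi
  · rw [CellAutomaton.extend_of_neg _ _ hi, if_neg hi.ne]
    obtain ⟨n, rfl⟩ : ∃ n : ℕ, i = -(n + 1 : ℕ) := ⟨(-i - 1).toNat, by omega⟩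
    change _ = ((ListBlank.mk []).nth n, none)
    rw [ListBlank.nth_mk]
    simp [toCellAutomaton, List.getI]
  · lift i to ℕ using hi
    change _ = ((Tape.mk' _ _).nth _, _)
    rw [CellAutomaton.extend_natCast, Tape.mk'_nth_nat, hR]
    rcases i with _ | i
    · cases l <;> simp [initWord, init]
    · have : ((i + 1 : ℕ) : ℤ) ≠ 0 := by omega
      rcases l with _ | ⟨a, l⟩
      · simp [initWord, toCellAutomaton]; omega
      · simp only [initWord, toCellAutomaton, List.tail_cons, List.getD_cons_succ, this, if_false]
        rcases lt_or_ge i l.length with h | h <;> simp [h]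

end Turing.TM0

/-! ### Computable initial words for a universal simulation -/

/-- The successor on binary representations, least significant bit first. -/
def binarySucc : List Bool → List Bool
  | [] => [true]
  | false :: l => true :: l
  | true :: l => false :: binarySucc l

theorem primrec_binarySucc : Primrec binarySucc := by
  have hh : Primrec₂ fun (_ : List Bool) (p : Bool × List Bool × List Bool) =>
      bif p.1 then false :: p.2.2 else true :: p.2.1 :=
    (Primrec.cond (Primrec.fst.comp Primrec.snd)
      (Primrec.list_cons.comp (Primrec.const false)
        (Primrec.snd.comp (Primrec.snd.comp Primrec.snd)))
      (Primrec.list_cons.comp (Primrec.const true)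
        (Primrec.fst.comp (Primrec.snd.comp Primrec.snd))))
  refine (Primrec.list_rec Primrec.id (Primrec.const [true]) hh).of_eq fun l => ?_
  simp only [id]
  induction l with
  | nil => rfl
  | cons b l ih => cases b <;> simp [binarySucc, ih]

/-- The binary representation of a number, least significant bit first. -/
def binary (n : ℕ) : List Bool := Nat.rec [] (fun _ l => binarySucc l) n

theorem primrec_binary : Primrec binary :=
  Primrec.nat_rec₁ _ (primrec_binarySucc.comp Primrec.snd)

namespace Turing.PartrecToTM2

/-- `binary` is primitive recursive by construction, so this identity makes the encoded input of the
compiled machine a computable function of `n`. -/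
theorem trNat_eq_map_binary (n : ℕ) :
    trNat n = (binary n).map fun b => bif b then Γ'.bit1 else Γ'.bit0 := by
  have hpos : ∀ (p : PosNum) (l : List Bool),
      trPosNum p = l.map (fun b => bif b then Γ'.bit1 else Γ'.bit0) →
      trPosNum p.succ = (binarySucc l).map fun b => bif b then Γ'.bit1 else Γ'.bit0 := by
    intro p
    induction p with
    | one =>
      rintro (_ | ⟨_ | _, _ | ⟨_, _⟩⟩) h <;> simp [trPosNum] at h
      simp [trPosNum, binarySucc, PosNum.succ]
    | bit0 p _ =>
      rintro (_ | ⟨_ | _, l⟩) h <;> simp [trPosNum] at h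
      simp [trPosNum, binarySucc, PosNum.succ, h]
    | bit1 p ih =>
      rintro (_ | ⟨_ | _, l⟩) h <;> simp [trPosNum] at h
      simp [trPosNum, binarySucc, PosNum.succ, ih _ h]
  induction n with
  | zero => simp [binary]
  | succ n ih =>
    have hb : binary (n + 1) = binarySucc (binary n) := rfl
    rw [hb, trNat, Nat.cast_succ, Num.add_one]
    rw [trNat] at ih
    cases hn : (n : Num) with
    | zero =>
      rw [hn] at ih
      have : binary n = [] := by simpa [trNum] using ih.symm
      rw [this]; rfl
    | pos p =>
      rw [hn] at ih
      exact hpos p _ ih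

instance : Fintype K' := ⟨{.main, .rev, .aux, .stack}, fun k => by cases k <;> simp⟩

end Turing.PartrecToTM2

open Turing in
/-- Every partial recursive function is simulated by a fixed cellular automaton, for which the
input is turned into an initial word by an algorithm. -/
theorem Partrec.exists_cellAutomaton {f : ℕ →. ℕ} (hf : Partrec f) :
    ∃ (N : ℕ) (C : CellAutomaton (Fin N)) (t : ℕ → List (Fin N)),
      C.rule C.blank C.blank C.blank = C.blank ∧ ¬ C.halting C.blank ∧ Computable t ∧
      ∀ n, C.Halts (t n) ↔ (f n).Dom := by
  obtain ⟨c, hc⟩ := ToPartrec.Code.exists_code (Nat.Partrec'.part_iff₁.2 hf)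
  -- The machines start in their default state, so the code `c` is installed as the default.
  let _ : Inhabited PartrecToTM2.Λ' := ⟨PartrecToTM2.trNormal c .halt⟩
  have h2 := PartrecToTM2.tr_supports c .halt
  have h1 := TM2to1.tr_supports _ h2
  have h0 := TM1to0.tr_supports _ h1
  set M := TM1to0.tr (TM2to1.tr PartrecToTM2.tr) with hM
  -- A finite set of states closed under the machine, which makes the alphabet of the cellular
  -- automaton finite.
  set S := TM1to0.trStmts (TM2to1.tr PartrecToTM2.tr)
    (TM2to1.trSupp PartrecToTM2.tr (PartrecToTM2.codeSupp c .halt)) with hS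
  have hfin : Finite (TM2to1.Γ' PartrecToTM2.K' (fun _ => PartrecToTM2.Γ') × Option S) :=
    inferInstance
  obtain ⟨N, ⟨e⟩⟩ := Finite.exists_equiv_fin
    (TM2to1.Γ' PartrecToTM2.K' (fun _ => PartrecToTM2.Γ') × Option S)
  let t : ℕ → List (TM2to1.Γ' PartrecToTM2.K' fun _ => PartrecToTM2.Γ') := fun n =>
    TM2to1.trInit PartrecToTM2.K'.main (PartrecToTM2.trList [n])
  have hhalt : ∀ n, (TM0.toCellAutomaton M S).Halts (TM0.initWord h0.1 (t n)) ↔ (f n).Dom := by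
    intro n
    rw [(TM0.represents_initWord h0.1 (t n)).halts_iff h0]
    change (TM0.eval M (t n)).Dom ↔ _
    rw [hM, TM1to0.tr_eval]
    refine (TM2to1.tr_eval_dom PartrecToTM2.tr _ _).trans ?_
    have hi : (TM2.init PartrecToTM2.K'.main (PartrecToTM2.trList [n]) :
        PartrecToTM2.Cfg') = PartrecToTM2.init c [n] := by
      unfold TM2.init PartrecToTM2.init
      congr 1
      funext k
      cases k <;> rfl
    change (StateTransition.eval (TM2.step PartrecToTM2.tr) (TM2.init PartrecToTM2.K'.main
      (PartrecToTM2.trList [n]) : PartrecToTM2.Cfg')).Dom ↔ _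
    rw [hi, PartrecToTM2.tr_eval]
    have := hc ⟨[n], rfl⟩
    change (c.eval [n]).Dom ↔ _
    simp only at this
    rw [this]
    rfl
  refine ⟨N, (TM0.toCellAutomaton M S).congr e, fun n => (TM0.initWord h0.1 (t n)).map e,
    ?_, ?_, ?_, fun n => (CellAutomaton.congr_halts_iff _ _ _).trans (hhalt n)⟩
  · simp [CellAutomaton.congr, TM0.toCellAutomaton_blank]
  · simpa [CellAutomaton.congr] using TM0.not_halting_blank M S
  -- The tape holds the encoded input reversed. So the terminator comes first, in the head cell,
  -- which is the same for all `n`; the other cells are images of binary digits.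
  · have ht : ∃ (a : Fin N) (g : Bool → Fin N), ∀ n,
        (TM0.initWord h0.1 (t n)).map e = a :: (binary n).reverse.map g :=
      ⟨e ((true, Function.update (fun _ => Option.none) .main (some .cons)), some ⟨default, h0.1⟩),
        fun b => e ((false, Function.update (fun _ => Option.none) .main
          (some (bif b then .bit1 else .bit0))), Option.none), fun n => by
        have hrev : (PartrecToTM2.trList [n]).reverse = .cons :: (binary n).reverse.map
            fun b => bif b then PartrecToTM2.Γ'.bit1 else PartrecToTM2.Γ'.bit0 := by
          simp [PartrecToTM2.trNat_eq_map_binary]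
        simp only [t, TM2to1.trInit, hrev, TM0.initWord]
        refine congrArg (_ :: ·) ?_
        generalize (binary n).reverse = l
        induction l with
        | nil => rfl
        | cons b l ih => exact congrArg (_ :: ·) ih⟩
    obtain ⟨a, g, ht⟩ := ht
    simp only [ht]
    exact (Primrec.list_cons.comp (Primrec.const a) (Primrec.list_map
      (Primrec.list_reverse.comp primrec_binary)
      ((Primrec.dom_finite g).comp Primrec.snd).to₂)).to_comp

/-! ### Deterministic machines with one initial choice -/

/-- A total deterministic real-time pushdown machine, with states `Q`, letters `Λ` and pushdown
symbols `S`; `next q a Z` is the new state with the word that replaces the topmost symbol. -/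
structure StackMachine (Q Λ S : Type) where
  next : Q → Λ → S → Q × List S
  final : Q → Prop

namespace StackMachine

variable {Q Λ S : Type}

/-- Acceptance from the state `q` with pushdown `γ`. -/
def Accepts (D : StackMachine Q Λ S) : Q → List S → List Λ → Prop
  | q, _, [] => D.final q
  | _, [], _ :: _ => False
  | q, Z :: γ, a :: w => Accepts D (D.next q a Z).1 ((D.next q a Z).2 ++ γ) w

variable [Fintype Q] [Fintype Λ] [Fintype S]

/-- The name of an element of a finite type. -/
noncomputable def name {α : Type} [Fintype α] (a : α) : ℕ := (Fintype.equivFin α a : ℕ)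

omit [Fintype Q] [Fintype Λ] [Fintype S] in
theorem name_injective {α : Type} [Fintype α] : Function.Injective (name : α → ℕ) :=
  fun _ _ h => (Fintype.equivFin α).injective (Fin.ext h)

/-- The transition that reads `a` with `Z` on top of the pushdown in state `q`, goes to `q'` and
replaces `Z` by `push`. -/
noncomputable def transition (q : Q) (a : Λ) (Z : S) (q' : Q) (push : List S) : PDATransition :=
  ⟨name q, some (name a), name Z, name q', push.map name⟩

/-- The transition of the machine that is determined by a state, a letter and a pushdown
symbol. -/
noncomputable def transitionAt (D : StackMachine Q Λ S) (x : Q × Λ × S) : PDATransition :=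
  transition x.1 x.2.1 x.2.2 (D.next x.1 x.2.1 x.2.2).1 (D.next x.1 x.2.1 x.2.2).2

variable (D : StackMachine Q Λ S) (start : Q) (bottom : S) (a₁ : Λ) (q₁ : Q) (γ₁ : List S)

open scoped Classical in
/-- The pushdown automaton that behaves like `D` except that it may start by reading `a₁`, going to
`q₁` and replacing the bottom symbol by `γ₁`. -/
noncomputable def toPDA : PDA where
  alphabetSize := Fintype.card Λ
  transitions := transition start a₁ bottom q₁ γ₁ ::
    (Finset.univ : Finset (Q × Λ × S)).toList.map D.transitionAt
  start := name start
  bottom := name bottom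
  final := ((Finset.univ : Finset Q).filter D.final).toList.map name

theorem mem_transitions {t : PDATransition} :
    t ∈ (D.toPDA start bottom a₁ q₁ γ₁).transitions ↔
      t = transition start a₁ bottom q₁ γ₁ ∨ ∃ q a Z, t = D.transitionAt (q, a, Z) := by
  simp [toPDA, eq_comm]

theorem name_mem_final {q : Q} :
    name q ∈ (D.toPDA start bottom a₁ q₁ γ₁).final ↔ D.final q := by
  simp [toPDA, name_injective.eq_iff]

/-- The configuration of the automaton that corresponds to a state, a pushdown and a word. -/
noncomputable def config (q : Q) (γ : List S) (w : List Λ) :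
    (D.toPDA start bottom a₁ q₁ γ₁).Config :=
  ⟨name q, w.map (Fintype.equivFin Λ), γ.map name⟩

theorem step_config {q : Q} {γ : List S} {w : List Λ} {t : PDATransition}
    {c : (D.toPDA start bottom a₁ q₁ γ₁).Config}
    (h : PDA.Step _ (D.config start bottom a₁ q₁ γ₁ q γ w) t c) :
    ∃ Z γ' a w', γ = Z :: γ' ∧ w = a :: w' ∧
      ((q = start ∧ a = a₁ ∧ Z = bottom ∧ t = transition start a₁ bottom q₁ γ₁ ∧
          c = D.config start bottom a₁ q₁ γ₁ q₁ (γ₁ ++ γ') w') ∨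
        (t = D.transitionAt (q, a, Z) ∧ c = D.config start bottom a₁ q₁ γ₁ (D.next q a Z).1
          ((D.next q a Z).2 ++ γ') w')) := by
  generalize hc₀ : D.config start bottom a₁ q₁ γ₁ q γ w = c₀ at h
  cases h with
  | epsilon p Z q' push γ' w' h =>
    rcases (D.mem_transitions ..).1 h with h | ⟨_, _, _, h⟩ <;>
      simp [transition, transitionAt] at h
  | read p Z q' push γ' a w' h =>
    simp only [config, PDA.Config.mk.injEq] at hc₀
    obtain ⟨hp, hw, hγ⟩ := hc₀
    obtain ⟨b, w'', rfl, rfl, rfl⟩ := List.map_eq_cons_iff.1 hw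
    obtain ⟨Y, γ'', rfl, rfl, rfl⟩ := List.map_eq_cons_iff.1 hγ
    subst hp
    refine ⟨Y, γ'', b, w'', rfl, rfl, ?_⟩
    rcases (D.mem_transitions ..).1 h with h | ⟨p', b', Y', h⟩
    · left
      have h' := h
      simp only [transition, PDATransition.mk.injEq, Option.some.injEq] at h
      obtain ⟨h1, h2, h3, rfl, rfl⟩ := h
      exact ⟨name_injective h1, name_injective h2, name_injective h3, h', by simp [config]⟩
    · right
      have h' := h
      simp only [transition, transitionAt, PDATransition.mk.injEq, Option.some.injEq] at h
      obtain ⟨h1, h2, h3, h4, h5⟩ := h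
      cases name_injective h1
      cases name_injective (α := Λ) h2
      cases name_injective h3
      subst h4 h5
      exact ⟨h', by simp [config]⟩

theorem step_transitionAt (q : Q) (γ : List S) (w : List Λ) (a : Λ) (Z : S) :
    PDA.Step _ (D.config start bottom a₁ q₁ γ₁ q (Z :: γ) (a :: w)) (D.transitionAt (q, a, Z))
      (D.config start bottom a₁ q₁ γ₁ (D.next q a Z).1 ((D.next q a Z).2 ++ γ) w) := by
  have h := (D.mem_transitions start bottom a₁ q₁ γ₁).2 (.inr ⟨q, a, Z, rfl⟩)
  have := PDA.Step.read (M := D.toPDA start bottom a₁ q₁ γ₁) _ _ _ _ (γ.map name)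
    (Fintype.equivFin Λ a) (w.map (Fintype.equivFin Λ)) h
  rw [config, config, List.map_append]
  exact this

theorem step_transition (γ : List S) (w : List Λ) :
    PDA.Step _ (D.config start bottom a₁ q₁ γ₁ start (bottom :: γ) (a₁ :: w))
      (transition start a₁ bottom q₁ γ₁) (D.config start bottom a₁ q₁ γ₁ q₁ (γ₁ ++ γ) w) := by
  have h := (D.mem_transitions start bottom a₁ q₁ γ₁).2 (.inl rfl)
  have := PDA.Step.read (M := D.toPDA start bottom a₁ q₁ γ₁) _ _ _ _ (γ.map name)
    (Fintype.equivFin Λ a₁) (w.map (Fintype.equivFin Λ)) h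
  rw [config, config, List.map_append]
  exact this

theorem isRealTime_toPDA : (D.toPDA start bottom a₁ q₁ γ₁).IsRealTime := by
  intro t ht
  rcases (D.mem_transitions ..).1 ht with rfl | ⟨q, a, Z, rfl⟩ <;>
    simp [transition, transitionAt]

end StackMachine

/-- `r` is a computation from `c` that reads the whole input and ends in a final state. -/
def PDA.AcceptingRunFrom (M : PDA) (c : M.Config) (r : List PDATransition) : Prop :=
  ∃ q ∈ M.final, ∃ γ : List ℕ, M.Run c r ⟨q, [], γ⟩

theorem PDA.acceptingRunFrom_iff {M : PDA} {c : M.Config} {r : List PDATransition} :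
    M.AcceptingRunFrom c r ↔ (r = [] ∧ c.unread = [] ∧ c.state ∈ M.final) ∨
      ∃ t c' r', r = t :: r' ∧ M.Step c t c' ∧ M.AcceptingRunFrom c' r' := by
  constructor
  · rintro ⟨q, hq, γ, h⟩
    cases h with
    | nil => exact .inl ⟨rfl, rfl, hq⟩
    | cons hs hr => exact .inr ⟨_, _, _, rfl, hs, q, hq, γ, hr⟩
  · rintro (⟨rfl, h, hq⟩ | ⟨t, c', r', rfl, hs, q, hq, γ, hr⟩)
    · obtain ⟨q, w, γ⟩ := c
      cases h
      exact ⟨q, hq, γ, .nil _⟩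
    · exact ⟨q, hq, γ, .cons hs hr⟩

namespace StackMachine

variable {Q Λ S : Type} [Fintype Q] [Fintype Λ] [Fintype S] (D : StackMachine Q Λ S) (start : Q)
  (bottom : S) (a₁ : Λ) (q₁ : Q) (γ₁ : List S)

theorem acceptingRunFrom_nil {q : Q} {γ : List S} {r : List PDATransition} :
    PDA.AcceptingRunFrom _ (D.config start bottom a₁ q₁ γ₁ q γ []) r ↔ r = [] ∧ D.final q := by
  rw [PDA.acceptingRunFrom_iff]
  constructor
  · rintro (⟨hr, _, hf⟩ | ⟨t, c', r', rfl, hs, _⟩)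
    · exact ⟨hr, (D.name_mem_final ..).1 hf⟩
    · obtain ⟨_, _, _, _, _, h, _⟩ := D.step_config _ _ _ _ _ hs
      cases h
  · rintro ⟨rfl, hf⟩
    exact .inl ⟨rfl, rfl, (D.name_mem_final ..).2 hf⟩

theorem acceptingRunFrom_cons {q : Q} {γ : List S} {a : Λ} {w : List Λ}
    {r : List PDATransition} :
    PDA.AcceptingRunFrom _ (D.config start bottom a₁ q₁ γ₁ q γ (a :: w)) r ↔
      ∃ Z γ' r', γ = Z :: γ' ∧
      ((q = start ∧ a = a₁ ∧ Z = bottom ∧ r = transition start a₁ bottom q₁ γ₁ :: r' ∧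
        PDA.AcceptingRunFrom _ (D.config start bottom a₁ q₁ γ₁ q₁ (γ₁ ++ γ') w) r') ∨
      (r = D.transitionAt (q, a, Z) :: r' ∧ PDA.AcceptingRunFrom _
        (D.config start bottom a₁ q₁ γ₁ (D.next q a Z).1 ((D.next q a Z).2 ++ γ') w) r')) := by
  rw [PDA.acceptingRunFrom_iff]
  constructor
  · rintro (⟨_, h, _⟩ | ⟨t, c', r', rfl, hs, hr⟩)
    · cases h
    · obtain ⟨Z, γ', b, w', rfl, hw, h⟩ := D.step_config _ _ _ _ _ hs
      cases hw
      rcases h with ⟨hq, ha, hZ, rfl, rfl⟩ | ⟨rfl, rfl⟩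
      · exact ⟨Z, γ', r', rfl, .inl ⟨hq, ha, hZ, rfl, hr⟩⟩
      · exact ⟨Z, γ', r', rfl, .inr ⟨rfl, hr⟩⟩
  · rintro ⟨Z, γ', r', rfl, ⟨rfl, rfl, rfl, rfl, hr⟩ | ⟨rfl, hr⟩⟩
    · exact .inr ⟨_, _, _, rfl, D.step_transition .., hr⟩
    · exact .inr ⟨_, _, _, rfl, D.step_transitionAt .., hr⟩

variable {D start} (hs : ∀ q a Z, (D.next q a Z).1 ≠ start)

-- The extra transition is enabled only in `start`, which is never entered again. From any other
-- state the automaton therefore behaves like `D`.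
include hs in
theorem exists_acceptingRunFrom {q : Q} (hq : q ≠ start) (γ : List S) (w : List Λ) :
    (∃ r, PDA.AcceptingRunFrom _ (D.config start bottom a₁ q₁ γ₁ q γ w) r) ↔ D.Accepts q γ w := by
  induction w generalizing q γ with
  | nil => simp [acceptingRunFrom_nil, Accepts]
  | cons a w ih =>
    cases γ with
    | nil => simp [acceptingRunFrom_cons, Accepts]
    | cons Z γ =>
      rw [Accepts, ← ih (hs _ _ _)]
      constructor
      · rintro ⟨r, hr⟩
        obtain ⟨Z', γ', r', h, ⟨rfl, _⟩ | ⟨rfl, hr⟩⟩ := (D.acceptingRunFrom_cons ..).1 hr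
        · exact absurd rfl hq
        · cases h; exact ⟨r', hr⟩
      · rintro ⟨r, hr⟩
        exact ⟨_, (D.acceptingRunFrom_cons ..).2 ⟨Z, γ, r, rfl, .inr ⟨rfl, hr⟩⟩⟩

include hs in
theorem acceptingRunFrom_unique {q : Q} (hq : q ≠ start) {γ : List S} {w : List Λ}
    {r r' : List PDATransition}
    (h : PDA.AcceptingRunFrom _ (D.config start bottom a₁ q₁ γ₁ q γ w) r)
    (h' : PDA.AcceptingRunFrom _ (D.config start bottom a₁ q₁ γ₁ q γ w) r') : r = r' := by
  induction w generalizing q γ r r' with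
  | nil => rw [((acceptingRunFrom_nil ..).1 h).1, ((acceptingRunFrom_nil ..).1 h').1]
  | cons a w ih =>
    obtain ⟨Z, γ₂, s, rfl, ⟨rfl, _⟩ | ⟨rfl, hr⟩⟩ := (D.acceptingRunFrom_cons ..).1 h
    · exact absurd rfl hq
    · obtain ⟨Z', γ₃, s', e, ⟨rfl, _⟩ | ⟨rfl, hr'⟩⟩ := (D.acceptingRunFrom_cons ..).1 h'
      · exact absurd rfl hq
      · cases e
        rw [ih (hs _ _ _) hr hr']

-- The first step has at most two possibilities, and each leads out of `start`, where the
-- continuation is unique.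
include hs in
theorem isAmbiguous_toPDA (hq₁ : q₁ ≠ start) :
    (D.toPDA start bottom a₁ q₁ γ₁).IsAmbiguous 2 := by
  intro w
  obtain ⟨w, rfl⟩ : ∃ v : List Λ, w = v.map (Fintype.equivFin Λ) :=
    (Function.Surjective.list_map (Fintype.equivFin Λ).surjective w).imp fun _ h => h.symm
  have key : ∃ r₁ r₂, {r | PDA.AcceptingRunFrom _
      (D.config start bottom a₁ q₁ γ₁ start [bottom] w) r} ⊆ {r₁, r₂} := by
    cases w with
    | nil => exact ⟨[], [], fun r hr => .inl ((acceptingRunFrom_nil ..).1 hr).1⟩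
    | cons a w =>
      have hsub : ∀ P : List PDATransition → Prop, (∀ r r', P r → P r' → r = r') →
          ∃ r₁, ∀ r, P r → r = r₁ := fun P hP => by
        by_cases h : ∃ r, P r
        · exact ⟨h.choose, fun r hr => hP _ _ hr h.choose_spec⟩
        -- If there is no accepting continuation, any dummy run will do.
        · exact ⟨[], fun r hr => absurd ⟨r, hr⟩ h⟩
      obtain ⟨r₁, h₁⟩ := hsub _ fun r r' h h' => acceptingRunFrom_unique (D := D) (start := start)
        bottom a₁ q₁ γ₁ hs hq₁ (γ := γ₁) (w := w) h h'
      obtain ⟨r₂, h₂⟩ := hsub _ fun r r' h h' => acceptingRunFrom_unique (D := D) (start := start)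
        bottom a₁ q₁ γ₁ hs (hs start a bottom) (γ := (D.next start a bottom).2) (w := w) h h'
      refine ⟨transition start a₁ bottom q₁ γ₁ :: r₁, D.transitionAt (start, a, bottom) :: r₂,
        fun r hr => ?_⟩
      obtain ⟨Z, γ', r', e, ⟨_, _, _, rfl, hr⟩ | ⟨rfl, hr⟩⟩ := (D.acceptingRunFrom_cons ..).1 hr
      · cases e
        rw [List.append_nil] at hr
        exact .inl (by rw [h₁ _ hr])
      · cases e
        rw [List.append_nil] at hr
        exact .inr (by rw [h₂ _ hr]; rfl)
  obtain ⟨r₁, r₂, h⟩ := key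
  exact (Set.encard_le_encard h).trans (by
    simpa [one_add_one_eq_two] using Set.encard_insert_le {r₂} r₁)

include hs in
theorem mem_language_toPDA (hq₁ : q₁ ≠ start) (w : List Λ) :
    w.map (Fintype.equivFin Λ) ∈ (D.toPDA start bottom a₁ q₁ γ₁).language ↔
      D.Accepts start [bottom] w ∨ ∃ w', w = a₁ :: w' ∧ D.Accepts q₁ γ₁ w' := by
  change (∃ r, PDA.AcceptingRunFrom _ (D.config start bottom a₁ q₁ γ₁ start [bottom] w) r) ↔ _
  cases w with
  | nil => simp [acceptingRunFrom_nil, Accepts]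
  | cons a w =>
    rw [Accepts, ← exists_acceptingRunFrom bottom a₁ q₁ γ₁ hs (hs _ _ _)]
    constructor
    · rintro ⟨r, hr⟩
      obtain ⟨Z, γ', r', e, ⟨_, rfl, _, rfl, hr⟩ | ⟨rfl, hr⟩⟩ :=
        (D.acceptingRunFrom_cons ..).1 hr
      · cases e
        rw [List.append_nil] at hr
        exact .inr ⟨w, rfl, (exists_acceptingRunFrom bottom _ q₁ γ₁ hs hq₁ _ _).1 ⟨_, hr⟩⟩
      · cases e
        exact .inl ⟨_, hr⟩
    · rintro (⟨r, hr⟩ | ⟨w', e, hr⟩)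
      · exact ⟨_, (D.acceptingRunFrom_cons ..).2 ⟨bottom, [], r, rfl, .inr ⟨rfl, hr⟩⟩⟩
      · cases e
        obtain ⟨r, hr⟩ := (exists_acceptingRunFrom bottom a₁ q₁ γ₁ hs hq₁ _ _).2 hr
        exact ⟨_, (D.acceptingRunFrom_cons ..).2
          ⟨bottom, [], r, rfl, .inl ⟨rfl, rfl, rfl, rfl, by rwa [List.append_nil]⟩⟩⟩

end StackMachine

/-! ### Reversals and computability of the construction -/

theorem PDATransition.direction_ne_neg_one {t : PDATransition} (h : t.push ≠ []) :
    t.direction ≠ -1 := by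
  obtain ⟨_, _, _, _, _ | ⟨_, _ | _⟩⟩ := t
  · exact absurd rfl h
  · simp [direction]
  · simp [direction]

theorem PDATransition.direction_ne_one {t : PDATransition} (h : t.push.length ≤ 1) :
    t.direction ≠ 1 := by
  obtain ⟨_, _, _, _, _ | ⟨_, _ | _⟩⟩ := t
  · simp [direction]
  · simp [direction]
  · simp at h

namespace StackMachine

variable {Q Λ S : Type} [Fintype Q] [Fintype Λ] [Fintype S] {D : StackMachine Q Λ S} {start : Q}
  (bottom : S) (a₁ : Λ) (q₁ : Q) (γ₁ : List S)

/-- Before `down` the pushdown never shrinks; afterwards it never grows, and `down` is never left.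
The induction needs both bounds: one reversal is still available while the last nonzero direction is
not `-1`, and none occurs in `down` unless that direction is `1`. -/
theorem reversals_le (down : Q → Prop) (hs : ∀ q a Z, (D.next q a Z).1 ≠ start)
    (hup : ∀ q a Z, ¬ down q → (D.next q a Z).2 ≠ [])
    (hdown : ∀ q a Z, down q → (D.next q a Z).2.length ≤ 1 ∧ down (D.next q a Z).1)
    {q : Q} (hq : q ≠ start) {γ : List S} {w : List Λ} {r : List PDATransition}
    {c : (D.toPDA start bottom a₁ q₁ γ₁).Config}
    (h : PDA.Run _ (D.config start bottom a₁ q₁ γ₁ q γ w) r c) :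
    (∀ s, s ≠ -1 → PDA.reversals s (r.map PDATransition.direction) ≤ 1) ∧
      (down q → ∀ s, s ≠ 1 → PDA.reversals s (r.map PDATransition.direction) = 0) := by
  induction r generalizing q γ w with
  | nil => simp [PDA.reversals]
  | cons t r ih =>
    cases h with
    | cons hstep hr =>
      obtain ⟨Z, γ', a, w', rfl, rfl, ⟨rfl, _⟩ | ⟨rfl, rfl⟩⟩ := D.step_config _ _ _ _ _ hstep
      · exact absurd rfl hq
      obtain ⟨ih₁, ih₂⟩ := ih (hs _ _ _) hr
      rw [List.map_cons]
      by_cases hd : down q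
      · obtain ⟨hl, hd'⟩ := hdown q a Z hd
        have hdir : (D.transitionAt (q, a, Z)).direction ≠ 1 :=
          PDATransition.direction_ne_one (by simpa [transitionAt, transition] using hl)
        have i1 := ih₂ hd' (-1) (by decide)
        have i2 := ih₂ hd' 0 (by decide)
        have i3 := ih₁ 1 (by decide)
        generalize (D.transitionAt (q, a, Z)).direction = d at hdir
        refine ⟨fun s hs => ?_, fun _ s hs => ?_⟩ <;>
          cases d <;> cases s <;> simp_all [PDA.reversals]
      · have hdir : (D.transitionAt (q, a, Z)).direction ≠ -1 :=
          PDATransition.direction_ne_neg_one (by simpa [transitionAt, transition] using hup q a Z hd)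
        have i2 := ih₁ 0 (by decide)
        have i3 := ih₁ 1 (by decide)
        generalize (D.transitionAt (q, a, Z)).direction = d at hdir
        refine ⟨fun s hs => ?_, fun h => absurd h hd⟩
        cases d <;> cases s <;> simp_all [PDA.reversals]

theorem isReversalBounded_toPDA (down : Q → Prop) (hs : ∀ q a Z, (D.next q a Z).1 ≠ start)
    (hup : ∀ q a Z, ¬ down q → (D.next q a Z).2 ≠ [])
    (hdown : ∀ q a Z, down q → (D.next q a Z).2.length ≤ 1 ∧ down (D.next q a Z).1)
    (hstart : ¬ down start) (hq₁ : q₁ ≠ start) (hγ₁ : γ₁ ≠ []) :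
    (D.toPDA start bottom a₁ q₁ γ₁).IsReversalBounded 1 := by
  intro w r c h
  obtain ⟨w, rfl⟩ : ∃ v : List Λ, w = v.map (Fintype.equivFin Λ) :=
    (Function.Surjective.list_map (Fintype.equivFin Λ).surjective w).imp fun _ h => h.symm
  change PDA.Run _ (D.config start bottom a₁ q₁ γ₁ start [bottom] w) r c at h
  cases h with
  | nil => simp [PDA.reversals]
  | @cons _ _ _ t r hstep hr =>
    have key : t.direction ≠ -1 → (∀ s, s ≠ -1 →
        PDA.reversals s (r.map PDATransition.direction) ≤ 1) →
        PDA.reversals 0 ((t :: r).map PDATransition.direction) ≤ 1 := by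
      intro hdir h
      have h0 := h 0 (by decide)
      have h1 := h 1 (by decide)
      rw [List.map_cons]
      generalize t.direction = d at hdir
      cases d <;> simp_all [PDA.reversals]
    obtain ⟨Z, γ', a, w', hZ, rfl, ⟨_, _, _, rfl, rfl⟩ | ⟨rfl, rfl⟩⟩ :=
      D.step_config _ _ _ _ _ hstep
    · exact key (PDATransition.direction_ne_neg_one (by simpa [transition] using hγ₁))
        (reversals_le _ _ _ _ down hs hup hdown hq₁ hr).1
    · exact key (PDATransition.direction_ne_neg_one
          (by simpa [transitionAt, transition] using hup start a Z hstart))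
        (reversals_le _ _ _ _ down hs hup hdown (hs _ _ _) hr).1

/-- Only the pushed words vary with `n`. The enumerations and names of the finite types are chosen
noncomputably, but they are constants of the algorithm. -/
theorem computable_toPDA {D : ℕ → StackMachine Q Λ S}
    (hstate : ∀ q a Z n, ((D n).next q a Z).1 = ((D 0).next q a Z).1)
    (hpush : ∀ q a Z, Computable fun n => ((D n).next q a Z).2.map name)
    (hfinal : ∀ n, (D n).final = (D 0).final) :
    Computable fun n => (D n).toPDA start bottom a₁ q₁ γ₁ := by
  have ht : ∀ x, Computable fun n => (D n).transitionAt x := by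
    rintro ⟨q, a, Z⟩
    have : Computable fun n => PDATransition.equivProd.symm
        (name q, some (name a), name Z, name ((D 0).next q a Z).1,
          ((D n).next q a Z).2.map name) :=
      Primrec.of_equiv_symm.to_comp.comp ((Computable.const _).pair ((Computable.const _).pair
        ((Computable.const _).pair ((Computable.const _).pair (hpush q a Z)))))
    refine this.of_eq fun n => ?_
    simp [transitionAt, transition, hstate q a Z n, PDATransition.equivProd]
  have hlist : ∀ l : List (Q × Λ × S), Computable fun n => l.map (D n).transitionAt := by
    intro l
    induction l with
    | nil => exact Computable.const _
    | cons x l ih => exact Computable.list_cons.comp (ht x) ih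
  have : Computable fun n => PDA.equivProd.symm (Fintype.card Λ,
      transition start a₁ bottom q₁ γ₁ ::
        (Finset.univ : Finset (Q × Λ × S)).toList.map (D n).transitionAt, name start, name bottom,
        ((D 0).toPDA start bottom a₁ q₁ γ₁).final) :=
    Primrec.of_equiv_symm.to_comp.comp ((Computable.const _).pair
      ((Computable.list_cons.comp (Computable.const _) (hlist _)).pair (Computable.const _)))
  refine this.of_eq fun n => ?_
  have hf : ∀ E E' : StackMachine Q Λ S, E.final = E'.final →
      (E.toPDA start bottom a₁ q₁ γ₁).final = (E'.toPDA start bottom a₁ q₁ γ₁).final := by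
    rintro ⟨_, F⟩ ⟨_, F'⟩ (rfl : F = F')
    rfl
  rw [← hf _ _ (hfinal n)]
  rfl

end StackMachine

/-! ### The two tests of a computation history -/

/-- The letters of computation histories: cells of a word, separators of words, and a mark that
delimits the three parts of a history. -/
inductive HistoryLetter (A : Type)
  | cell (a : A)
  | sep
  | mark
  deriving DecidableEq, Fintype

/-- The states of the machine that looks for errors in a computation history. -/
inductive CheckState (A : Type)
  | start
  | sink
  | done
  | copy
  | pop (halted : Bool)
  | store (second : Bool)
  | scan (u v : A)
  deriving Fintype

namespace CellAutomaton

open HistoryLetter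

variable {A : Type} (C : CellAutomaton A) (w : List A)

open scoped Classical in
/-- The transition function of the error finder.  From `start` it verifies that a history has the
form `# p $ w $ pᴿ # x $`, where `x` contains a halting symbol; from `store` it verifies that each
block in the last part is the image of the corresponding block in the first two. -/
noncomputable def checkNext : CheckState A → HistoryLetter A → Option (HistoryLetter A) →
    CheckState A × List (Option (HistoryLetter A))
  | .start, sep, Z => (.copy, [some sep, Z])
  | .copy, mark, Z => (.pop false, w.map (fun a => some (cell a)) ++ [some mark, Z])
  | .copy, a, Z => (.copy, [some a, Z])
  | .pop h, a, some z => if a = z then (.pop h, []) else (.sink, [some z])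
  | .pop h, cell x, none => (.pop (h || decide (C.halting x)), [none])
  | .pop true, mark, none => (.done, [none])
  | .store i, cell x, Z => (.store i, [some (cell x), Z])
  -- The image of a block is two cells longer than the block. Two blanks beneath each stored block
  -- let `scan` remove one symbol per letter read, as real time requires.
  | .store i, sep, Z => (.store i, [some (cell C.blank), some (cell C.blank), some sep, Z])
  | .store false, mark, Z =>
    (.store true, [some (cell C.blank), some (cell C.blank), some sep, Z])
  | .store true, mark, Z => (.scan C.blank C.blank, [Z])
  | .scan u v, cell y, some (cell x) =>
    if y = C.rule x u v then (.scan x u, []) else (.sink, [some (cell x)])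
  | .scan _ _, sep, some sep => (.scan C.blank C.blank, [])
  | .scan _ _, mark, none => (.done, [none])
  | _, _, Z => (.sink, [Z])

/-- The error finder as a deterministic machine. -/
noncomputable def checker : StackMachine (CheckState A) (HistoryLetter A)
    (Option (HistoryLetter A)) where
  next := C.checkNext w
  final q := q ≠ .done

/-- The pushdown with content `s` above the bottom symbol. -/
def stackOf (s : List (HistoryLetter A)) : List (Option (HistoryLetter A)) := s.map some ++ [none]

/-- The topmost symbol is kept, so the rest of the input can always be read: a detected error means
acceptance. -/
theorem accepts_sink (Z : Option (HistoryLetter A)) (γ : List (Option (HistoryLetter A)))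
    (u : List (HistoryLetter A)) : (C.checker w).Accepts .sink (Z :: γ) u := by
  induction u generalizing Z with
  | nil => simp [StackMachine.Accepts, checker]
  | cons a u ih =>
    rw [StackMachine.Accepts]
    simpa [checker, checkNext] using ih Z

theorem accepts_done (Z : Option (HistoryLetter A)) (γ : List (Option (HistoryLetter A)))
    (u : List (HistoryLetter A)) : (C.checker w).Accepts .done (Z :: γ) u ↔ u ≠ [] := by
  cases u with
  | nil => simp [StackMachine.Accepts, checker]
  | cons a u =>
    rw [StackMachine.Accepts]
    simpa [checker, checkNext] using C.accepts_sink w Z γ u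

theorem accepts_pop_nil (h : Bool) (u : List (HistoryLetter A)) :
    ¬ (C.checker w).Accepts (.pop h) [none] u ↔
      ∃ x : List A, u = x.map cell ++ [mark] ∧ (h = true ∨ ∃ a ∈ x, C.halting a) := by
  induction u generalizing h with
  | nil => simp [StackMachine.Accepts, checker]
  | cons a u ih =>
    rw [StackMachine.Accepts]
    cases a with
    | cell a =>
      have : (C.checker w).next (.pop h) (cell a) none =
        (.pop (h || @decide (C.halting a) (Classical.propDecidable _)), [none]) := rfl
      simp only [this, List.singleton_append, ih]
      constructor
      · rintro ⟨x, rfl, hx⟩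
        refine ⟨a :: x, rfl, ?_⟩
        simpa [or_assoc] using hx
      · rintro ⟨_ | ⟨b, x⟩, hu, hx⟩
        · simp at hu
        · simp only [List.map_cons, List.cons_append, List.cons.injEq, cell.injEq] at hu
          obtain ⟨rfl, rfl⟩ := hu
          exact ⟨x, rfl, by simpa [or_assoc] using hx⟩
    | sep =>
      have : (C.checker w).next (.pop h) sep none = (.sink, [none]) := by cases h <;> rfl
      simp only [this, List.singleton_append, C.accepts_sink, not_true_eq_false, false_iff]
      rintro ⟨_ | ⟨b, x⟩, hu, hx⟩ <;> simp at hu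
    | mark =>
      cases h with
      | false =>
        have : (C.checker w).next (.pop false) mark none = (.sink, [none]) := rfl
        simp only [this, List.singleton_append, C.accepts_sink, not_true_eq_false, false_iff]
        rintro ⟨_ | ⟨b, x⟩, hu, hx⟩ <;> simp at hu hx
      | true =>
        have : (C.checker w).next (.pop true) mark none = (.done, [none]) := rfl
        simp only [this, List.singleton_append, C.accepts_done, not_not]
        constructor
        · rintro rfl; exact ⟨[], rfl, by simp⟩
        · rintro ⟨_ | ⟨b, x⟩, hu, hx⟩ <;> simp at hu; exact hu

theorem accepts_pop (h : Bool) (s u : List (HistoryLetter A)) :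
    ¬ (C.checker w).Accepts (.pop h) (stackOf s) u ↔
      ∃ x : List A, u = s ++ x.map cell ++ [mark] ∧ (h = true ∨ ∃ a ∈ x, C.halting a) := by
  induction s generalizing u with
  | nil => simpa [stackOf] using C.accepts_pop_nil w h u
  | cons z s ih =>
    cases u with
    | nil => simp [StackMachine.Accepts, checker]
    | cons a u =>
      rw [stackOf, List.map_cons, List.cons_append, StackMachine.Accepts]
      by_cases ha : a = z
      · subst ha
        have : (C.checker w).next (.pop h) a (some a) = (.pop h, []) := by
          cases h <;> simp [checker, checkNext]
        simp only [this]
        rw [List.nil_append, ← stackOf, ih]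
        simp
      · have : (C.checker w).next (.pop h) a (some z) = (.sink, [some z]) := by
          cases h <;> simp [checker, checkNext, ha]
        simp [this, C.accepts_sink, ha]

theorem accepts_copy (s u : List (HistoryLetter A)) :
    ¬ (C.checker w).Accepts .copy (stackOf s) u ↔
      ∃ p u', mark ∉ p ∧ u = p ++ mark :: u' ∧ ¬ (C.checker w).Accepts (.pop false)
        (stackOf (w.map cell ++ mark :: (p.reverse ++ s))) u' := by
  induction u generalizing s with
  | nil => simp [StackMachine.Accepts, checker]
  | cons a u ih =>
    obtain ⟨Z, γ, hZ⟩ : ∃ Z γ, stackOf s = Z :: γ := by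
      cases s <;> simp [stackOf]
    by_cases ha : a = mark
    · subst ha
      rw [hZ, StackMachine.Accepts]
      have : (C.checker w).next .copy mark Z =
        (.pop false, w.map (fun a => some (cell a)) ++ [some mark, Z]) := rfl
      have hst : w.map (fun a => some (cell a)) ++ [some mark, Z] ++ γ =
          stackOf (w.map cell ++ mark :: s) := by
        rw [stackOf, List.map_append, List.map_map, List.map_cons, List.append_assoc,
          List.append_assoc, List.cons_append, List.cons_append, List.nil_append, ← hZ]
        rfl
      simp only [this, hst]
      constructor
      · intro h
        exact ⟨[], u, by simp, rfl, h⟩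
      · rintro ⟨_ | ⟨b, p⟩, u', hp, hu, h⟩
        · cases hu; exact h
        · simp only [List.cons_append, List.cons.injEq] at hu
          simp [← hu.1] at hp
    · rw [hZ, StackMachine.Accepts]
      have : (C.checker w).next .copy a Z = (.copy, [some a, Z]) := by
        cases a <;> first | rfl | exact absurd rfl ha
      have hst : [some a, Z] ++ γ = stackOf (a :: s) := by
        rw [List.cons_append, List.singleton_append, ← hZ]; rfl
      simp only [this, hst, ih]
      constructor
      · rintro ⟨p, u', hp, rfl, h⟩
        exact ⟨a :: p, u', by simp [hp, Ne.symm ha], rfl, by simpa using h⟩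
      · rintro ⟨_ | ⟨b, p⟩, u', hp, hu, h⟩
        · cases hu; exact absurd rfl ha
        · cases hu
          exact ⟨p, u', by simp at hp; exact hp.2, rfl, by simpa using h⟩

/-- The word that the machine expects after the second mark, if it has stored `s`. -/
def expected : A → A → List (HistoryLetter A) → List (HistoryLetter A)
  | u, v, [] => [cell (C.rule C.blank u v), cell (C.rule C.blank C.blank u)]
  | u, v, cell x :: s => cell (C.rule x u v) :: expected x u s
  | u, v, _ :: s => cell (C.rule C.blank u v) :: cell (C.rule C.blank C.blank u) :: sep ::
      expected C.blank C.blank s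

/-- The pushdown when `s` has been stored. -/
def storedStack : List (HistoryLetter A) → List (Option (HistoryLetter A))
  | [] => [some (cell C.blank), some (cell C.blank), none]
  | cell x :: s => some (cell x) :: storedStack s
  | _ :: s => some (cell C.blank) :: some (cell C.blank) :: some sep :: storedStack s

theorem accepts_scan_cell (u v x : A) (γ : List (Option (HistoryLetter A)))
    (r : List (HistoryLetter A)) :
    ¬ (C.checker w).Accepts (.scan u v) (some (cell x) :: γ) r ↔
      ∃ r', r = cell (C.rule x u v) :: r' ∧ ¬ (C.checker w).Accepts (.scan x u) γ r' := by
  cases r with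
  | nil => simp [StackMachine.Accepts, checker]
  | cons a r =>
    rw [StackMachine.Accepts]
    cases a with
    | cell y =>
      by_cases hy : y = C.rule x u v
      · simp [checker, checkNext, hy]
      · have : (C.checker w).next (.scan u v) (cell y) (some (cell x)) =
            (.sink, [some (cell x)]) := by simp [checker, checkNext, hy]
        simp [this, C.accepts_sink, hy]
    | sep =>
      have : (C.checker w).next (.scan u v) sep (some (cell x)) = (.sink, [some (cell x)]) := rfl
      simp [this, C.accepts_sink]
    | mark =>
      have : (C.checker w).next (.scan u v) mark (some (cell x)) = (.sink, [some (cell x)]) := rfl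
      simp [this, C.accepts_sink]

theorem accepts_scan_sep (u v : A) (γ : List (Option (HistoryLetter A)))
    (r : List (HistoryLetter A)) :
    ¬ (C.checker w).Accepts (.scan u v) (some sep :: γ) r ↔
      ∃ r', r = sep :: r' ∧ ¬ (C.checker w).Accepts (.scan C.blank C.blank) γ r' := by
  cases r with
  | nil => simp [StackMachine.Accepts, checker]
  | cons a r =>
    rw [StackMachine.Accepts]
    cases a with
    | cell y =>
      have : (C.checker w).next (.scan u v) (cell y) (some sep) = (.sink, [some sep]) := rfl
      simp [this, C.accepts_sink]
    | sep => simp [checker, checkNext]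
    | mark =>
      have : (C.checker w).next (.scan u v) mark (some sep) = (.sink, [some sep]) := rfl
      simp [this, C.accepts_sink]

theorem accepts_scan_nil (u v : A) (r : List (HistoryLetter A)) :
    ¬ (C.checker w).Accepts (.scan u v) [none] r ↔ r = [mark] := by
  cases r with
  | nil => simp [StackMachine.Accepts, checker]
  | cons a r =>
    rw [StackMachine.Accepts]
    cases a with
    | cell y =>
      have : (C.checker w).next (.scan u v) (cell y) none = (.sink, [none]) := rfl
      simp [this, C.accepts_sink]
    | sep =>
      have : (C.checker w).next (.scan u v) sep none = (.sink, [none]) := rfl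
      simp [this, C.accepts_sink]
    | mark =>
      have : (C.checker w).next (.scan u v) mark none = (.done, [none]) := rfl
      simp [this, C.accepts_done]

theorem storedStack_ne_nil (s : List (HistoryLetter A)) : C.storedStack s ≠ [] := by
  rcases s with _ | ⟨_ | _ | _, _⟩ <;> simp [storedStack]

/-- Every pushdown symbol leaves only one next letter that avoids `sink`, so exactly one
continuation is rejected. -/
theorem accepts_scan (u v : A) (s r : List (HistoryLetter A)) :
    ¬ (C.checker w).Accepts (.scan u v) (C.storedStack s) r ↔ r = C.expected u v s ++ [mark] := by
  induction s generalizing u v r with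
  | nil => simp [storedStack, accepts_scan_cell, accepts_scan_nil, expected]
  | cons a s ih =>
    cases a <;> simp [storedStack, accepts_scan_cell, accepts_scan_sep, expected, ih]

theorem accepts_store (i : Bool) (p s u : List (HistoryLetter A)) (hp : mark ∉ p) :
    (C.checker w).Accepts (.store i) (C.storedStack s) (p ++ u) ↔
      (C.checker w).Accepts (.store i) (C.storedStack (p.reverse ++ s)) u := by
  induction p generalizing s with
  | nil => rfl
  | cons a p ih =>
    obtain ⟨Z, γ, hZ⟩ := List.exists_cons_of_ne_nil (C.storedStack_ne_nil s)
    simp only [List.mem_cons, not_or] at hp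
    rw [List.reverse_cons, List.append_assoc, List.singleton_append, ← ih _ hp.2, hZ,
      List.cons_append, StackMachine.Accepts]
    cases a with
    | cell x => cases i <;> simp [checker, checkNext, storedStack, hZ]
    | sep => cases i <;> simp [checker, checkNext, storedStack, hZ]
    | mark => exact absurd rfl hp.1

/-- The first mark is stored as a separator, and the second one starts the comparison. Storing
reverses the order, so the middle block is compared first. -/
theorem accepts_store_mark (s p r : List (HistoryLetter A)) (hs : mark ∉ s) (hp : mark ∉ p) :
    ¬ (C.checker w).Accepts (.store false) (C.storedStack [])
      (p ++ mark :: (s ++ mark :: r)) ↔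
      r = C.expected C.blank C.blank (s.reverse ++ sep :: p.reverse) ++ [mark] := by
  rw [accepts_store _ _ _ _ _ _ hp, List.append_nil]
  obtain ⟨Z, γ, hZ⟩ := List.exists_cons_of_ne_nil (C.storedStack_ne_nil p.reverse)
  have h1 : (C.checker w).Accepts (.store false) (C.storedStack p.reverse)
      (mark :: (s ++ mark :: r)) ↔
      (C.checker w).Accepts (.store true) (C.storedStack (sep :: p.reverse)) (s ++ mark :: r) := by
    rw [hZ, StackMachine.Accepts]
    simp [checker, checkNext, storedStack, hZ]
  rw [h1, accepts_store _ _ _ _ _ _ hs, ← C.accepts_scan w]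
  obtain ⟨Z, γ, hZ⟩ :=
    List.exists_cons_of_ne_nil (C.storedStack_ne_nil (s.reverse ++ sep :: p.reverse))
  rw [hZ, StackMachine.Accepts]
  simp [checker, checkNext]

end CellAutomaton

/-! ### Histories as solutions of a word equation, and their lengths -/

namespace CellAutomaton

open HistoryLetter

variable {A : Type} (C : CellAutomaton A)

theorem expected_map_cell (u v : A) (t : List A) :
    C.expected u v (t.map cell) = (C.scan u v t).map cell := by
  induction t generalizing u v with
  | nil => rfl
  | cons x t ih => simp [expected, scan, ih]

theorem expected_map_cell_append (u v : A) (t : List A) (s : List (HistoryLetter A)) :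
    C.expected u v (t.map cell ++ sep :: s) =
      (C.scan u v t).map cell ++ sep :: C.expected C.blank C.blank s := by
  induction t generalizing u v with
  | nil => rfl
  | cons x t ih => simp [expected, scan, ih]

/-- The first `m + 1` successors of `t`, with separators between them. -/
def trace : ℕ → List A → List (HistoryLetter A)
  | 0, t => (C.next t).map cell
  | m + 1, t => (C.next t).map cell ++ sep :: trace m (C.next t)

theorem mark_notMem_trace (m : ℕ) (t : List A) : mark ∉ C.trace m t := by
  induction m generalizing t with
  | zero => simp [trace]
  | succ m ih => simp [trace, ih]

theorem length_trace (m : ℕ) (t : List A) :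
    (C.trace m t).length = (m + 1) * (t.length + 2) + m * (m + 1) + m := by
  induction m generalizing t with
  | zero => simp [trace]
  | succ m ih => simp [trace, ih]; ring

theorem map_cell_append_sep_inj {x y : List A} {s s' : List (HistoryLetter A)}
    (h : x.map cell ++ sep :: s = y.map cell ++ sep :: s') : x = y ∧ s = s' := by
  induction x generalizing y with
  | nil => cases y <;> simp_all
  | cons a x ih =>
    cases y with
    | nil => simp at h
    | cons b y =>
      simp only [List.map_cons, List.cons_append, List.cons.injEq, cell.injEq] at h
      obtain ⟨rfl, rfl⟩ := ih h.2
      exact ⟨by rw [h.1], rfl⟩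

theorem eq_map_cell_or {s : List (HistoryLetter A)} (hs : mark ∉ s) :
    ∃ y : List A, s = y.map cell ∨ ∃ s', s = y.map cell ++ sep :: s' := by
  induction s with
  | nil => exact ⟨[], .inl rfl⟩
  | cons a s ih =>
    simp only [List.mem_cons, not_or] at hs
    cases a with
    | cell a =>
      obtain ⟨y, h⟩ := ih hs.2
      refine ⟨a :: y, h.imp (fun h => by rw [h]; rfl) ?_⟩
      rintro ⟨s', rfl⟩
      exact ⟨s', rfl⟩
    | sep => exact ⟨[], .inr ⟨s, rfl⟩⟩
    | mark => exact absurd rfl hs.1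

/-- The words that are one block ahead of their own image are the traces. -/
theorem append_eq_expected_iff {s : List (HistoryLetter A)} (hs : mark ∉ s) (t x : List A) :
    s ++ sep :: x.map cell = C.expected C.blank C.blank (t.map cell ++ sep :: s) ↔
      ∃ m, s = C.trace m t ∧ x = C.next^[m + 2] t := by
  rw [expected_map_cell_append]
  change _ = (C.next t).map cell ++ _ ↔ _
  constructor
  · intro h
    -- The first block of `s` must be `C.next t`. If it is all of `s`, then `x` is the next image
    -- and `m = 0`. Otherwise it is cut off, and the same equation holds for the rest with `C.next
    -- t` in place of `t`.
    induction hn : s.length using Nat.strong_induction_on generalizing s t with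
    | _ n ih =>
      obtain ⟨y, rfl | ⟨s', rfl⟩⟩ := eq_map_cell_or hs
      · obtain ⟨rfl, h⟩ := map_cell_append_sep_inj h
        rw [expected_map_cell] at h
        exact ⟨0, rfl, (List.map_injective_iff.2 fun _ _ => cell.inj) h⟩
      · rw [List.append_assoc, List.cons_append] at h
        obtain ⟨rfl, h⟩ := map_cell_append_sep_inj h
        rw [expected_map_cell_append] at h
        obtain ⟨m, rfl, rfl⟩ := ih s'.length (by simp [← hn]; omega) (s := s') (by simp at hs; exact hs)
          (C.next t) h rfl
        exact ⟨m + 1, rfl, rfl⟩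
  · rintro ⟨m, rfl, rfl⟩
    clear hs
    induction m generalizing t with
    | zero => rw [trace, expected_map_cell]; rfl
    | succ m ih =>
      rw [trace, expected_map_cell_append, List.append_assoc, List.cons_append]
      have := ih (C.next t)
      rw [Function.iterate_succ_apply, this]
      rfl

/-- The history of `m + 2` steps from `t`. -/
def history (m : ℕ) (t : List A) : List (HistoryLetter A) :=
  sep :: ((C.trace m t).reverse ++ mark :: (t.reverse.map cell ++ mark ::
    (C.trace m t ++ sep :: (C.next^[m + 2] t).map cell ++ [mark])))

theorem length_history (m : ℕ) (t : List A) : (C.history m t).length =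
    2 * ((m + 1) * (t.length + 2) + m * (m + 1) + m) + 2 * t.length + 2 * m + 9 := by
  simp only [history, List.length_cons, List.length_append, List.length_reverse, List.length_map,
    List.length_nil, length_trace, length_iterate_next]
  ring

/-- The blocks grow by two cells per step, so the length is quadratic in `m` and the distance
between consecutive lengths is unbounded. -/
theorem length_history_succ (m : ℕ) (t : List A) :
    (C.history m t).length + m < (C.history (m + 1) t).length := by
  rw [length_history, length_history]
  nlinarith

theorem length_history_mono (t : List A) : Monotone fun m => (C.history m t).length :=
  monotone_nat_of_le_succ fun m => by
    have := C.length_history_succ m t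
    omega

/-! ### The automaton that rejects exactly the halting histories -/

variable [Fintype A]

/-- The pushdown automaton that accepts the words that are not halting histories from `t`. -/
noncomputable def checkerPDA (t : List A) : PDA :=
  (C.checker t.reverse).toPDA .start none sep (.store false)
    [some (cell C.blank), some (cell C.blank), none]

omit [Fintype A] in
theorem checkNext_ne_start (w : List A) (q : CheckState A) (a : HistoryLetter A)
    (Z : Option (HistoryLetter A)) : (C.checkNext w q a Z).1 ≠ .start := by
  unfold checkNext
  split <;> (try split_ifs) <;> simp

theorem isRealTime_checkerPDA (t : List A) : (C.checkerPDA t).IsRealTime :=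
  StackMachine.isRealTime_toPDA _ _ _ _ _ _

theorem isAmbiguous_checkerPDA (t : List A) : (C.checkerPDA t).IsAmbiguous 2 :=
  StackMachine.isAmbiguous_toPDA _ _ _ _ (C.checkNext_ne_start _) (by simp)

/-- The states from which the error finder never increases the pushdown. -/
def _root_.CheckState.down : CheckState A → Prop
  | .start | .copy | .store _ => False
  | _ => True

theorem isReversalBounded_checkerPDA (t : List A) : (C.checkerPDA t).IsReversalBounded 1 := by
  refine StackMachine.isReversalBounded_toPDA _ _ _ _ CheckState.down (C.checkNext_ne_start _)
    ?_ ?_ id (by simp) (by simp)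
  · rintro (_ | _ | _ | _ | _ | (_ | _) | _) (_ | _ | _) (_ | _ | _ | _) <;>
      simp [CheckState.down, checker, checkNext]
  · rintro (_ | _ | _ | _ | (_ | _) | _ | _) (_ | _ | _) (_ | _ | _ | _) <;>
      simp [CheckState.down, checker, checkNext] <;> split_ifs <;> simp

/-- The word `t` enters only through what is pushed at the first mark in state `copy`; all other
transitions are constant. -/
theorem computable_checkerPDA {t : ℕ → List A} [Primcodable A] (ht : Computable t) :
    Computable fun n => C.checkerPDA (t n) := by
  refine StackMachine.computable_toPDA (D := fun n => C.checker (t n).reverse) _ _ _ _ ?_ ?_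
    fun _ => rfl
  · intro q a Z n
    change (C.checkNext _ q a Z).1 = (C.checkNext _ q a Z).1
    unfold checkNext
    split <;> rfl
  · intro q a Z
    by_cases h : q = .copy ∧ a = mark
    · obtain ⟨rfl, rfl⟩ := h
      have hm : Computable fun n =>
          (t n).reverse.map fun a => StackMachine.name (some (cell a)) :=
        (Primrec.list_map (Primrec.list_reverse.comp Primrec.id)
          ((Primrec.dom_finite fun a : A => StackMachine.name (some (cell a))).comp
            Primrec.snd).to₂).to_comp.comp ht
      refine (Computable.list_append.comp hm
        (Computable.const ([some mark, Z].map StackMachine.name))).of_eq fun n => ?_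
      change _ = (C.checkNext _ _ _ _).2.map _
      simp [checkNext, Function.comp_def]
    · refine (Computable.const ((C.checkNext [] q a Z).2.map StackMachine.name)).of_eq fun n => ?_
      change _ = (C.checkNext _ q a Z).2.map _
      congr 2
      unfold checkNext
      split <;> simp_all

theorem notMem_language_checkerPDA (t : List A) (v : List (HistoryLetter A)) :
    v.map (Fintype.equivFin (HistoryLetter A)) ∉ (C.checkerPDA t).language ↔
      ∃ m, v = C.history m t ∧ ∃ a ∈ C.next^[m + 2] t, C.halting a := by
  refine (not_congr (StackMachine.mem_language_toPDA _ _ _ _ (C.checkNext_ne_start _)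
    (by simp) v)).trans ?_
  rw [not_or]
  -- The first letter # is already read. Rejection by the first test gives the shape and the halting
  -- symbol; rejection by the second then becomes the word equation for the reversed first part.
  have key : ∀ u : List (HistoryLetter A),
      (¬ (C.checker t.reverse).Accepts .copy (stackOf [sep]) u ∧
        ¬ (C.checker t.reverse).Accepts (.store false) (C.storedStack []) u) ↔
      ∃ m, sep :: u = C.history m t ∧ ∃ a ∈ C.next^[m + 2] t, C.halting a := by
    intro u
    rw [accepts_copy]
    simp only [accepts_pop]
    have hw : mark ∉ t.reverse.map (cell : A → HistoryLetter A) := by simp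
    constructor
    · rintro ⟨⟨p, u', hp, rfl, x, rfl, hx⟩, h⟩
      rw [show t.reverse.map cell ++ mark :: (p.reverse ++ [sep]) ++ x.map cell ++ [mark] =
        t.reverse.map cell ++ mark :: (p.reverse ++ sep :: x.map cell ++ [mark]) by simp,
        accepts_store_mark _ _ _ _ _ hw hp, List.append_cancel_right_eq, ← List.map_reverse,
        List.reverse_reverse, append_eq_expected_iff _ (by simpa using hp)] at h
      obtain ⟨m, hm, rfl⟩ := h
      refine ⟨m, ?_, by simpa using hx⟩
      rw [history, ← hm]
      simp
    · rintro ⟨m, hu, hx⟩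
      rw [history, List.cons.injEq] at hu
      obtain ⟨-, rfl⟩ := hu
      have hp : mark ∉ (C.trace m t).reverse := by simpa using C.mark_notMem_trace m t
      refine ⟨⟨_, _, hp, rfl, _, by simp, .inr hx⟩, ?_⟩
      rw [accepts_store_mark _ _ _ _ _ hw hp, List.append_cancel_right_eq, ← List.map_reverse,
        List.reverse_reverse, List.reverse_reverse,
        append_eq_expected_iff _ (C.mark_notMem_trace m t)]
      exact ⟨m, rfl, rfl⟩
  cases v with
  | nil => simp [StackMachine.Accepts, checker, history]
  | cons a u =>
    rw [StackMachine.Accepts]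
    cases a with
    | sep =>
      rw [← key]
      simp [checker, checkNext, stackOf, storedStack]
    | cell a =>
      have : (C.checker t.reverse).next .start (cell a) none = (.sink, [none]) := rfl
      simp [this, accepts_sink, history]
    | mark =>
      have : (C.checker t.reverse).next .start mark none = (.sink, [none]) := rfl
      simp [this, accepts_sink, history]

theorem mem_compl_language_checkerPDA (t : List A)
    (v : List (Fin (C.checkerPDA t).alphabetSize)) :
    v ∈ (C.checkerPDA t).languageᶜ ↔ ∃ m, (∃ a ∈ C.next^[m + 2] t, C.halting a) ∧
      v = (C.history m t).map (Fintype.equivFin (HistoryLetter A)) := by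
  obtain ⟨u, rfl⟩ : ∃ u : List (HistoryLetter A), v = u.map (Fintype.equivFin _) :=
    (Function.Surjective.list_map (Fintype.equivFin (HistoryLetter A)).surjective v).imp
      fun _ h => h.symm
  refine (C.notMem_language_checkerPDA t u).trans (exists_congr fun m => ?_)
  rw [and_comm]
  refine and_congr_right fun _ => ?_
  exact (List.map_injective_iff.2 (Fintype.equivFin (HistoryLetter A)).injective).eq_iff.symm

theorem hasLengthGaps_of_halts (hb : C.rule C.blank C.blank C.blank = C.blank)
    (hh : ¬ C.halting C.blank) {t : List A} (h : C.Halts t) :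
    ((C.checkerPDA t).languageᶜ).HasLengthGaps := by
  obtain ⟨m₀, hm₀⟩ := h.exists_forall_ge hb hh
  intro d
  have hd := C.length_history_succ (m₀ + d) t
  -- The gap lies between the lengths for `m₀ + d` and `m₀ + d + 1`, which differ by more than `d`.
  -- The summand `m₀` ensures that the longer history is halting.
  refine ⟨(C.history (m₀ + d) t).length + 1, fun v hv => ?_, _,
    (C.mem_compl_language_checkerPDA t _).2 ⟨m₀ + d + 1, hm₀ _ (by omega), rfl⟩, ?_⟩
  · obtain ⟨k, _, rfl⟩ := (C.mem_compl_language_checkerPDA t v).1 hv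
    have hl : (List.map (Fintype.equivFin (HistoryLetter A)) (C.history k t)).length =
      (C.history k t).length := List.length_map _
    change (List.map (Fintype.equivFin (HistoryLetter A)) (C.history k t)).length < _ ∨
      _ ≤ (List.map (Fintype.equivFin (HistoryLetter A)) (C.history k t)).length
    rw [hl]
    rcases le_or_gt k (m₀ + d) with hk | hk
    · have := C.length_history_mono t hk
      simp only at this
      omega
    · have := C.length_history_mono t (Nat.succ_le_of_lt hk)
      simp only [Nat.succ_eq_add_one] at this
      omega
  · change _ ≤ (List.map (Fintype.equivFin (HistoryLetter A)) _).length
    rw [List.length_map]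
    omega

theorem notMem_compl_of_not_halts {t : List A} (h : ¬ C.Halts t)
    (v : List (Fin (C.checkerPDA t).alphabetSize)) : v ∉ (C.checkerPDA t).languageᶜ := by
  rw [mem_compl_language_checkerPDA]
  rintro ⟨m, hm, _⟩
  exact h ⟨_, hm⟩

theorem countingRegular_language_checkerPDA (hb : C.rule C.blank C.blank C.blank = C.blank)
    (hh : ¬ C.halting C.blank) (t : List A) :
    (C.checkerPDA t).language.CountingRegular ↔ ¬ C.Halts t := by
  refine ⟨fun hr h => (C.hasLengthGaps_of_halts hb hh h).not_countingRegular_of_compl hr,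
    fun h => Language.countingRegular_of_forall_mem fun v => ?_⟩
  exact not_not.1 (C.notMem_compl_of_not_halts h v)

theorem countingRegular_compl_language_checkerPDA
    (hb : C.rule C.blank C.blank C.blank = C.blank) (hh : ¬ C.halting C.blank) (t : List A) :
    ((C.checkerPDA t).languageᶜ).CountingRegular ↔ ¬ C.Halts t :=
  ⟨fun hr h => (C.hasLengthGaps_of_halts hb hh h).not_countingRegular hr,
    fun h => Language.countingRegular_of_forall_notMem (C.notMem_compl_of_not_halts h)⟩

end CellAutomaton

/-! ### Undecidability -/

/-- The universal function that runs the `n`-th code on 0 works, since non-halting is not even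
recursively enumerable. A single `f` suffices, so the cellular automaton and its finite alphabet are
fixed. -/
theorem exists_partrec_not_computablePred_dom :
    ∃ f : ℕ →. ℕ, Partrec f ∧ ¬ ComputablePred fun n => ¬ (f n).Dom := by
  refine ⟨fun n => (Denumerable.ofNat Nat.Partrec.Code n).eval 0,
    Nat.Partrec.Code.eval_part.comp (Computable.ofNat _) (Computable.const 0), fun h => ?_⟩
  obtain ⟨b, hb, he⟩ := ComputablePred.computable_iff.1 h
  refine ComputablePred.halting_problem_not_re 0 (ComputablePred.to_re
    (ComputablePred.computable_iff.2 ⟨_, hb.comp Computable.encode, funext fun c => ?_⟩))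
  simpa using congrFun he (Encodable.encode c)

/-- A decision procedure on a promise decides every predicate that reduces to the problem by
instances that fulfil the promise. -/
theorem DecidableGiven.computablePred {α : Type} [Primcodable α] {promise p : α → Prop}
    (h : DecidableGiven promise p) {g : ℕ → α} (hg : Computable g) (hp : ∀ n, promise (g n)) :
    ComputablePred fun n => p (g n) := by
  obtain ⟨f, hf, h⟩ := h
  choose b hb hbp using fun n => h (g n) (hp n)
  have hbc : Computable b := (hf.comp hg).of_eq fun n => Part.eq_some_iff.2 (hb n)
  exact ComputablePred.computable_iff.2 ⟨b, hbc, funext fun n => propext (hbp n).symm⟩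

theorem mainTheorem6 :
    ¬ DecidableGiven
        (fun M : PDA => M.IsRealTime ∧ M.IsAmbiguous 2 ∧ M.IsReversalBounded 1)
        (fun M : PDA => M.language.CountingRegular) ∧
    ¬ DecidableGiven
        (fun M : PDA => M.IsRealTime ∧ M.IsAmbiguous 2 ∧ M.IsReversalBounded 1)
        (fun M : PDA => (M.languageᶜ).CountingRegular) := by
  obtain ⟨f, hf, hnot⟩ := exists_partrec_not_computablePred_dom
  obtain ⟨N, C, t, hb, hh, ht, hhalts⟩ := hf.exists_cellAutomaton
  have hp : ∀ n, (C.checkerPDA (t n)).IsRealTime ∧ (C.checkerPDA (t n)).IsAmbiguous 2 ∧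
      (C.checkerPDA (t n)).IsReversalBounded 1 := fun n =>
    ⟨C.isRealTime_checkerPDA _, C.isAmbiguous_checkerPDA _, C.isReversalBounded_checkerPDA _⟩
  constructor <;> intro h <;> refine hnot ?_
  · have := h.computablePred (C.computable_checkerPDA ht) hp
    simpa only [C.countingRegular_language_checkerPDA hb hh, hhalts] using this
  · have := h.computablePred (C.computable_checkerPDA ht) hp
    simpa only [C.countingRegular_compl_language_checkerPDA hb hh, hhalts] using this
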